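/- \textbf{Proposition.} The problem \textsc{Max $k$-Set Cover}, parameterized by $k$, belongs to the class $\mathrm{W}[\mathrm{P}]$. Here \textsc{Max $k$-Set Cover} is the following decision problem: given a family $\mathcal S=(S_1,\dots,S_m)$ of subsets of a finite set $X$ (described by the list of the elements of $X$ and the characteristic vectors of the sets), a natural number $p$ (in binary), and the parameter $k\in\mathbb N$, is there a subfamily of at most $k$ of the sets whose union has at least $p$ elements? $\mathrm{W}[\mathrm{P}]$ is the class of all parameterized problems that are fpt-reducible to \textsc{Weighted Circuit Satisfiability}: given a Boolean circuit $C$ (AND, OR and NOT gates, without any restriction on depth, weft or fan-in of the AND and OR gates) and the parameter $k$, is there an assignment setting exactly $k$ inputs of $C$ to true on which $C$ outputs true? A parameterized problem $P$ is fpt-reducible to a parameterized problem $Q$ if there are computable functions $F,g:\mathbb N\to\mathbb N$, a polynomial $q$, and a map $f:(x,k)\mapsto(x',k')$ from instances of $P$ to instances of $Q$ such that $(x,k)$ is a yes-instance of $P$ if and only if $(x',k')$ is a yes-instance of $Q$, always $k'\le g(k)$, and $f$ is computed by a deterministic Turing machine in at most $F(k)\,q(n)$ steps, where $n$ is the length of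 the encoding of $(x,k)$. -/

import Mathlib

namespace ParamComplexity

/-! ### Parameterized problems and fpt-reductions -/

/-- A parameterized decision problem: a set of pairs `(x, k)` consisting of an instance `x`, given by
a word over a finite alphabet, and a natural number `k`, the parameter.  For `Inst = List Sym` and
`encode = id` this is exactly a subset of `Σ* × ℕ`. -/
structure ParamProblem where
  /-- the instances -/
  Inst : Type
  /-- the alphabet -/
  Sym : Type
  /-- the alphabet is finite -/
  [symFintype : Fintype Sym]
  /-- the word that describes an instance -/
  encode : Inst → List Sym
  /-- different instances have different descriptions -/
  encode_injective : Function.Injective encode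
  /-- the pairs with answer "yes" -/
  yes : Set (Inst × ℕ)

/-- The word on which a machine is started for the pair `(x, k)`: the description of `x`
followed by the binary expansion of `k` (over a disjoint copy of the alphabet `{0, 1}`). -/
def ParamProblem.input (P : ParamProblem) (a : P.Inst × ℕ) : List (P.Sym ⊕ Bool) :=
  (P.encode a.1).map Sum.inl ++ (Computability.encodeNat a.2).map Sum.inr

/-- `f` is computed by a deterministic Turing machine in at most `F(k) * q(n)` steps, where `k` is the
parameter, `n` the length of the input word, `F` a computable function and `q` a polynomial. -/
def FPTComputable (P Q : ParamProblem) (f : P.Inst × ℕ → Q.Inst × ℕ) : Prop :=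
  ∃ M : Turing.TM2ComputableAux (P.Sym ⊕ Bool) (Q.Sym ⊕ Bool),
    (∀ s, Finite (M.tm.Γ s)) ∧
    ∃ (F : ℕ → ℕ) (q : Polynomial ℕ), Computable F ∧
      ∀ a : P.Inst × ℕ,
        Nonempty (Turing.TM2OutputsInTime M.tm
          ((P.input a).map M.inputAlphabet.symm)
          (some ((Q.input (f a)).map M.outputAlphabet.symm))
          (F a.2 * q.eval (P.input a).length))

/-- Parameterized (many-one) reducibility: an fpt-computable map that preserves the answers and under
which the new parameter is bounded by a computable function of the old one. -/
def FPTReducible (P Q : ParamProblem) : Prop :=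
  ∃ f : P.Inst × ℕ → Q.Inst × ℕ,
    (∀ a, a ∈ P.yes ↔ f a ∈ Q.yes) ∧
    (∃ g : ℕ → ℕ, Computable g ∧ ∀ a, (f a).2 ≤ g a.2) ∧
    FPTComputable P Q f

/-! ### A fact on words made of marked blocks -/

/-- If every block starts with a marker and contains no other marker, and different objects have
different blocks, then a list of objects is determined by the concatenation of its blocks. -/
theorem flatMap_injective {α σ : Type} (mark : σ → Bool) (f : α → List σ)
    (hf : Function.Injective f)
    (hm : ∀ a, ∃ h t, f a = h :: t ∧ mark h = true ∧ ∀ x ∈ t, mark x = false) :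
    Function.Injective (List.flatMap f) := by
  have key : ∀ l : List α, (l.flatMap f).takeWhile (fun x => !mark x) = [] := by
    intro l
    cases l with
    | nil => rfl
    | cons a l =>
      obtain ⟨h, t, e, hh, -⟩ := hm a
      simp [List.flatMap_cons, e, hh]
  have tw : ∀ (t : List σ) (l : List α), (∀ x ∈ t, mark x = false) →
      (t ++ l.flatMap f).takeWhile (fun x => !mark x) = t := by
    intro t l ht
    rw [List.takeWhile_append_of_pos (by simpa using ht), key, List.append_nil]
  intro l₁
  induction l₁ with
  | nil =>
    intro l₂ h
    cases l₂ with
    | nil => rfl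
    | cons b l =>
      obtain ⟨x, t, e, -, -⟩ := hm b
      simp [List.flatMap_cons, e] at h
  | cons a l ih =>
    intro l₂ h
    cases l₂ with
    | nil =>
      obtain ⟨x, t, e, -, -⟩ := hm a
      simp [List.flatMap_cons, e] at h
    | cons b l₂ =>
      obtain ⟨x, t, e, -, ht⟩ := hm a
      obtain ⟨y, u, e', -, hu⟩ := hm b
      have h0 : x :: (t ++ l.flatMap f) = y :: (u ++ l₂.flatMap f) := by
        simpa [List.flatMap_cons, e, e'] using h
      obtain ⟨hxy, h1⟩ := List.cons.inj h0
      have htu : t = u := by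
        rw [← tw t l ht, ← tw u l₂ hu, h1]
      subst htu hxy
      have hab : a = b := hf (e.trans e'.symm)
      rw [hab, ih (List.append_cancel_left h1)]

/-! ### Boolean circuits and weighted circuit satisfiability -/

/-- A gate of a Boolean circuit, with the numbers of the wires that it reads. -/
inductive Gate where
  | conj (args : List ℕ)
  | disj (args : List ℕ)
  | neg (arg : ℕ)

/-- The wires read by a gate. -/
def Gate.args : Gate → List ℕ
  | conj l => l
  | disj l => l
  | neg a => [a]

/-- The value of a gate, given the values of the wires. -/
def Gate.eval (v : ℕ → Bool) : Gate → Bool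
  | conj l => l.all v
  | disj l => l.any v
  | neg a => !v a

/-- A Boolean circuit with one output and gates of arbitrary fan-in and fan-out.  The wires `0`, …,
`numInputs - 1` carry the inputs; wire `numInputs + i` carries the value of the `i`-th gate, which
reads only wires of smaller number (a topological ordering of the underlying acyclic graph). -/
structure Circuit where
  numInputs : ℕ
  gates : List Gate
  /-- the wire that carries the output -/
  output : ℕ
  acyclic : ∀ (i : ℕ) (h : i < gates.length), ∀ a ∈ (gates[i]).args, a < numInputs + i
  output_lt : output < numInputs + gates.length

/-- The values of all wires, in order. -/
def Circuit.wires (C : Circuit) (x : Fin C.numInputs → Bool) : List Bool :=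
  C.gates.foldl (fun w g => w ++ [g.eval (fun i => w.getD i false)]) (List.ofFn x)

/-- The output of a circuit on a given assignment to its inputs. -/
def Circuit.eval (C : Circuit) (x : Fin C.numInputs → Bool) : Bool :=
  (C.wires x).getD C.output false

/-- The alphabet for descriptions of circuits. -/
inductive CircuitSym where
  | input | out | conj | disj | neg | arg | one
  deriving DecidableEq

instance : Fintype CircuitSym :=
  ⟨{.input, .out, .conj, .disj, .neg, .arg, .one}, by intro x; cases x <;> decide⟩

/-- A list of wires, each as a mark followed by its number in unary. -/
def encodeArgs (l : List ℕ) : List CircuitSym :=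
  l.flatMap fun a => .arg :: List.replicate a .one

/-- A gate is described by its kind followed by the wires that it reads. -/
def Gate.encode : Gate → List CircuitSym
  | conj l => .conj :: encodeArgs l
  | disj l => .disj :: encodeArgs l
  | neg a => .neg :: encodeArgs [a]

/-- The description of a circuit: one symbol per input, the number of the output wire, and the list of
gates.  (Unary numbers of wires make the word at most polynomially longer than binary ones,
because every input and every gate is listed.) -/
def Circuit.encode (C : Circuit) : List CircuitSym :=
  List.replicate C.numInputs .input ++ .out :: (List.replicate C.output .one ++
    C.gates.flatMap Gate.encode)

theorem encodeArgs_injective : Function.Injective encodeArgs := by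
  refine flatMap_injective (fun s => decide (s = .arg)) _ ?_ ?_
  · intro a b h
    simpa using congrArg List.length h
  · intro a
    refine ⟨_, _, rfl, by simp, ?_⟩
    intro x hx
    simp [List.eq_of_mem_replicate hx]

theorem Gate.encode_injective : Function.Injective Gate.encode := by
  intro g h e
  cases g <;> cases h <;> simp only [Gate.encode, List.cons.injEq, reduceCtorEq, false_and,
    true_and] at e
  · rw [encodeArgs_injective e]
  · rw [encodeArgs_injective e]
  · simpa using encodeArgs_injective e

theorem mem_encodeArgs {l : List ℕ} {x : CircuitSym} (h : x ∈ encodeArgs l) :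
    x = .arg ∨ x = .one := by
  simp only [encodeArgs, List.mem_flatMap, List.mem_cons, List.mem_replicate] at h
  grind

/-- The symbols that open the description of a gate. -/
def CircuitSym.isKind : CircuitSym → Bool
  | conj | disj | neg => true
  | _ => false

theorem Gate.encode_eq (g : Gate) :
    ∃ h t, g.encode = h :: t ∧ h.isKind = true ∧ ∀ x ∈ t, x.isKind = false := by
  cases g <;> refine ⟨_, _, rfl, rfl, fun x hx => ?_⟩ <;>
    rcases mem_encodeArgs hx with rfl | rfl <;> rfl

theorem gates_injective : Function.Injective (List.flatMap Gate.encode) :=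
  flatMap_injective CircuitSym.isKind _ Gate.encode_injective Gate.encode_eq

/-- A run of one symbol before a word that does not start with it can be read off. -/
theorem replicate_append_inj {σ : Type} (s : σ) {m n : ℕ} {u v : List σ}
    (hu : u.head? ≠ some s) (hv : v.head? ≠ some s)
    (h : List.replicate m s ++ u = List.replicate n s ++ v) : m = n ∧ u = v := by
  induction m generalizing n with
  | zero =>
    cases n with
    | zero => simpa using h
    | succ n =>
      simp only [List.replicate_zero, List.nil_append, List.replicate_succ,
        List.cons_append] at h
      exact absurd (by rw [h]; rfl) hu
  | succ m ih =>
    cases n with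
    | zero =>
      simp only [List.replicate_zero, List.nil_append, List.replicate_succ,
        List.cons_append] at h
      exact absurd (by rw [← h]; rfl) hv
    | succ n =>
      simp only [List.replicate_succ, List.cons_append, List.cons.injEq, true_and] at h
      obtain ⟨h1, h2⟩ := ih h
      exact ⟨by rw [h1], h2⟩

theorem Circuit.encode_injective : Function.Injective Circuit.encode := by
  have hg : ∀ l : List Gate, (l.flatMap Gate.encode).head? ≠ some .one := by
    intro l
    cases l with
    | nil => simp
    | cons g l =>
      obtain ⟨h, t, e, hh, -⟩ := Gate.encode_eq g
      rw [List.flatMap_cons, e]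
      rintro ⟨⟩
      simp [CircuitSym.isKind] at hh
  rintro ⟨n, l, o, h1, h2⟩ ⟨n', l', o', h1', h2'⟩ h
  simp only [Circuit.encode] at h
  obtain ⟨rfl, hout⟩ := replicate_append_inj _ (by simp) (by simp) h
  obtain ⟨rfl, hgates⟩ := replicate_append_inj _ (hg l) (hg l') (List.cons.inj hout).2
  obtain rfl := gates_injective hgates
  rfl

/-- **Weighted Circuit Satisfiability**: given a Boolean circuit and the parameter `k`, is there an
assignment with exactly `k` inputs set to true on which the circuit outputs true? -/
def weightedCircuitSat : ParamProblem where
  Inst := Circuit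
  Sym := CircuitSym
  encode := Circuit.encode
  encode_injective := Circuit.encode_injective
  yes := {a | ∃ x : Fin a.1.numInputs → Bool,
    (Finset.univ.filter fun i => x i = true).card = a.2 ∧ a.1.eval x = true}

/-- The class W[P]: the parameterized problems that are fpt-reducible to Weighted Circuit
Satisfiability (for circuits without any restriction on depth or weft). -/
def InWP (P : ParamProblem) : Prop :=
  FPTReducible P weightedCircuitSat

/-! ### Max k-Set Cover -/

/-- A family `S 0, …, S (m - 1)` of subsets of an `n`-element set, and the number `p` of elements that
have to be covered. -/
structure SetFamily where
  n : ℕ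
  m : ℕ
  S : Fin m → Finset (Fin n)
  p : ℕ

/-- The alphabet for descriptions of set families. -/
inductive FamilySym where
  | elem | target | bit (b : Bool) | set | mem (b : Bool)
  deriving DecidableEq, Fintype

/-- The description of one subset: its characteristic vector, after a mark. -/
def encodeSet {n : ℕ} (A : Finset (Fin n)) : List FamilySym :=
  .set :: List.ofFn fun j => .mem (decide (j ∈ A))

/-- The description of a set family: one symbol per element of the ground set, the binary expansion of
`p`, and the list of the subsets. -/
def SetFamily.encode (I : SetFamily) : List FamilySym :=
  List.replicate I.n .elem ++ .target :: ((Computability.encodeNat I.p).map .bit ++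
    (List.ofFn I.S).flatMap encodeSet)

theorem encodeSet_injective {n : ℕ} : Function.Injective (encodeSet (n := n)) := by
  intro A B h
  simp only [encodeSet, List.cons.injEq, true_and] at h
  have h' := List.ofFn_injective h
  ext j
  simpa using congrFun h' j

/-- The symbols that describe a binary number. -/
def FamilySym.isBit : FamilySym → Bool
  | bit _ => true
  | _ => false

theorem bits_append_inj {b c : List Bool} {u v : List FamilySym}
    (hu : u.takeWhile FamilySym.isBit = []) (hv : v.takeWhile FamilySym.isBit = [])
    (h : b.map FamilySym.bit ++ u = c.map FamilySym.bit ++ v) : b = c ∧ u = v := by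
  have hb : ∀ d : List Bool, ∀ x ∈ d.map FamilySym.bit, x.isBit = true := by
    intro d x hx
    obtain ⟨y, -, rfl⟩ := List.mem_map.1 hx
    rfl
  have h' := congrArg (List.takeWhile FamilySym.isBit) h
  rw [List.takeWhile_append_of_pos (hb b), List.takeWhile_append_of_pos (hb c), hu, hv,
    List.append_nil, List.append_nil] at h'
  have hbc : b = c := List.map_injective_iff.2 (fun x y h => by simpa using h) h'
  subst hbc
  exact ⟨rfl, List.append_cancel_left h⟩

theorem SetFamily.encode_injective : Function.Injective SetFamily.encode := by
  have hs : ∀ {n : ℕ} (l : List (Finset (Fin n))),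
      (l.flatMap encodeSet).takeWhile FamilySym.isBit = [] := by
    intro n l
    cases l with
    | nil => rfl
    | cons A l => simp [List.flatMap_cons, encodeSet, FamilySym.isBit]
  rintro ⟨n, m, S, p⟩ ⟨n', m', S', p'⟩ h
  simp only [SetFamily.encode] at h
  obtain ⟨rfl, h⟩ := replicate_append_inj _ (by simp) (by simp) h
  simp only [List.cons.injEq, true_and] at h
  obtain ⟨hp, hfl⟩ := bits_append_inj (hs _) (hs _) h
  have hpp : p = p' := by
    rw [← Computability.decode_encodeNat p, hp, Computability.decode_encodeNat]
  subst hpp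
  have hl : List.ofFn S = List.ofFn S' := by
    refine flatMap_injective (fun s => decide (s = .set)) encodeSet encodeSet_injective ?_ hfl
    intro A
    refine ⟨_, _, rfl, by simp, ?_⟩
    intro x hx
    obtain ⟨j, rfl⟩ := (List.mem_ofFn' _ _).1 hx
    simp
  have hm : m = m' := by simpa using congrArg List.length hl
  subst hm
  rw [List.ofFn_injective hl]

/-- **Max k-Set Cover**, parameterized by `k`: given a family of subsets of a finite set and a
number `p`, are there at most `k` sets of the family that together cover at least `p` elements? -/
def maxKSetCover : ParamProblem where
  Inst := SetFamily
  Sym := FamilySym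
  encode := SetFamily.encode
  encode_injective := SetFamily.encode_injective
  yes := {a | ∃ T : Finset (Fin a.1.m), T.card ≤ a.2 ∧ a.1.p ≤ (T.biUnion a.1.S).card}

end ParamComplexity

namespace ParamComplexity

open Function Turing

/-! ### Structured programs on stacks -/

/-! A choice of sets is a choice of true inputs, so it suffices to write down, in fpt time, a
circuit that checks whether the chosen sets cover at least `p` elements. Besides one input per set
it has `k + 1` padding inputs that no gate reads; they absorb the difference between "at most `k`
sets" and "exactly `k` true inputs" (`SetFamily.circuit_correct`).

Coverage is computed by rows of disjunctions, one row per set. Counting is a dynamic program: with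
`c l` the number of covered elements among the first `l`, the wire for `(l, d)` says `u ≤ d + c l`,
and `u ≤ d + c (l + 1)` holds iff `u ≤ d + c l`, or element `l` is covered and `u ≤ (d + 1) + c l`.
Since `p` is given in binary it may be exponentially large; it is replaced by `u = min p (n + 1)`,
which asks the same because only `n` elements exist. So `n + 2` values of `d` suffice and the
circuit has polynomial size (`thresholdCoverGates_value`).

The larger share of the proof is the machine. A small language of stack programs is compiled into
`TM2` machines with a bound on the steps (`Prog.Runs.reaches`, `Prog.Runs.machine_outputs`), and the
reduction is written and verified in it, with wire numbers kept in unary on stacks. Expanding the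
parameter to unary takes time depending on the value of `k`, which the factor `F k` pays for.
`exec_reduction` bounds the time by a cubic polynomial in a number `B` that dominates the input
length and the number of wires, and `reduction_time` supplies such a `B` as a product of a function
of `k` and a polynomial in the length. The parameter itself does not change. -/

/-- Structured programs that work on finitely many stacks. -/
inductive Prog {K : Type} (Γ : K → Type) : Type
  | skip : Prog Γ
  | push (k : K) (a : Γ k) : Prog Γ
  | seq (p q : Prog Γ) : Prog Γ
  /-- pop symbols from stack `k` until it is empty, and run the body on each of them -/
  | loop (k : K) (body : Γ k → Prog Γ) : Prog Γ
  /-- pop one symbol, if there is one, and branch on it -/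
  | test (k : K) (body : Option (Γ k) → Prog Γ) : Prog Γ

namespace Prog

variable {K : Type} {Γ : K → Type}

/-- The program points. -/
def Lab : Prog Γ → Type
  | skip => Unit
  | push _ _ => Unit
  | seq p q => p.Lab ⊕ q.Lab
  | loop _ body => Option (Σ a, (body a).Lab)
  | test _ body => Option (Σ a, (body a).Lab)

/-- A loop or a test has a separate copy of its body for every possible outcome of the pop, so the
alphabets must be finite for the machine to have finitely many labels. -/
theorem finite_lab [∀ k, Finite (Γ k)] (p : Prog Γ) : Finite p.Lab := by
  induction p with
  | skip => exact inferInstanceAs (Finite Unit)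
  | push => exact inferInstanceAs (Finite Unit)
  | seq p q hp hq => exact inferInstanceAs (Finite (p.Lab ⊕ q.Lab))
  | loop k body h => exact inferInstanceAs (Finite (Option (Σ a, (body a).Lab)))
  | test k body h => exact inferInstanceAs (Finite (Option (Σ a, (body a).Lab)))

/-- The first program point. -/
def start : (p : Prog Γ) → p.Lab
  | skip => ()
  | push _ _ => ()
  | seq p _ => Sum.inl p.start
  | loop _ _ => none
  | test _ _ => none

variable [DecidableEq K] {Λ : Type}

/-- Pop stack `k`, remember the result, and jump according to it. -/
def popGoto (k : K) (f : Option (Γ k) → Λ) : TM2.Stmt Γ Λ (∀ k, Option (Γ k)) :=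
  .pop k (fun v o => update v k o) (.goto fun v => f (v k))

/-- The statement at a program point, for a given embedding of the program points into the labels
of a machine and a given label to continue with. -/
def code : (p : Prog Γ) → (p.Lab → Λ) → Λ → p.Lab → TM2.Stmt Γ Λ (∀ k, Option (Γ k))
  | skip, _, exit, _ => .goto fun _ => exit
  | push k a, _, exit, _ => .push k (fun _ => a) (.goto fun _ => exit)
  | seq p q, emb, _, Sum.inl l => p.code (emb ∘ Sum.inl) (emb (Sum.inr q.start)) l
  | seq _ q, emb, exit, Sum.inr l => q.code (emb ∘ Sum.inr) exit l
  | loop k body, emb, exit, none =>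
      popGoto k fun o => o.elim exit fun a => emb (some ⟨a, (body a).start⟩)
  | loop _ body, emb, _, some ⟨a, l⟩ =>
      (body a).code (fun l => emb (some ⟨a, l⟩)) (emb none) l
  | test k body, emb, _, none => popGoto k fun o => emb (some ⟨o, (body o).start⟩)
  | test _ body, emb, exit, some ⟨a, l⟩ =>
      (body a).code (fun l => emb (some ⟨a, l⟩)) exit l

/-- `Runs p S S' t`: started on the stacks `S`, the program `p` ends with the stacks `S'` after at
most `t` steps. -/
inductive Runs : Prog Γ → (∀ k, List (Γ k)) → (∀ k, List (Γ k)) → ℕ → Prop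
  | skip (S) : Runs .skip S S 1
  | push (S k a) : Runs (.push k a) S (update S k (a :: S k)) 1
  | seq {p q S S' S'' t t'} : Runs p S S' t → Runs q S' S'' t' → Runs (.seq p q) S S'' (t + t')
  | loop_nil {k body S} : S k = [] → Runs (.loop k body) S S 1
  | loop_cons {k body S S' S'' a l t t'} : S k = a :: l → Runs (body a) (update S k l) S' t →
      Runs (.loop k body) S' S'' t' → Runs (.loop k body) S S'' (t + t' + 1)
  | test {k body S S' t} : Runs (body (S k).head?) (update S k (S k).tail) S' t →
      Runs (.test k body) S S' (t + 1)
  | weaken {p S S' t t'} : Runs p S S' t → t ≤ t' → Runs p S S' t'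

/-- Correctness of the compilation. The embedding and the exit stay universally quantified so that
the induction can place a subprogram anywhere in a larger machine. The memory `v` may be arbitrary
because every jump depends only on the symbol popped just before it. -/
theorem Runs.reaches {M : Λ → TM2.Stmt Γ Λ (∀ k, Option (Γ k))} {p : Prog Γ}
    {S S' : ∀ k, List (Γ k)} {t : ℕ} (h : Runs p S S' t) :
    ∀ (emb : p.Lab → Λ) (exit : Λ), (∀ l, M (emb l) = p.code emb exit l) →
      ∀ v, ∃ v' t', t' ≤ t ∧
        (flip bind (TM2.step M))^[t'] (some ⟨some (emb p.start), v, S⟩) =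
          some ⟨some exit, v', S'⟩ := by
  induction h with
  | skip S =>
    intro emb exit hM v
    refine ⟨v, 1, le_rfl, ?_⟩
    simp [flip, hM, code]
  | push S k a =>
    intro emb exit hM v
    refine ⟨v, 1, le_rfl, ?_⟩
    simp [flip, hM, code]
  | @seq p q S S' S'' t t' _ _ ihp ihq =>
    intro emb exit hM v
    obtain ⟨v₁, t₁, ht₁, h₁⟩ := ihp (emb ∘ Sum.inl) (emb (Sum.inr q.start))
      (fun l => hM (Sum.inl l)) v
    obtain ⟨v₂, t₂, ht₂, h₂⟩ := ihq (emb ∘ Sum.inr) exit (fun l => hM (Sum.inr l)) v₁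
    refine ⟨v₂, t₂ + t₁, by omega, ?_⟩
    rw [iterate_add_apply]
    exact (congrArg _ h₁).trans h₂
  | @loop_nil k body S hS =>
    intro emb exit hM v
    refine ⟨update v k none, 1, le_rfl, ?_⟩
    have hn : M (emb none) = popGoto k fun o =>
        o.elim exit fun a => emb (some ⟨a, (body a).start⟩) := hM none
    have : update S k [] = S := by rw [← hS, update_eq_self]
    simp [flip, hn, start, popGoto, hS, this]
  | @loop_cons k body S S' S'' a l t t' hS _ _ ihb ihl =>
    intro emb exit hM v
    have hn : M (emb none) = popGoto k fun o =>
        o.elim exit fun a => emb (some ⟨a, (body a).start⟩) := hM none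
    -- The body exits to `emb none`, the head of the loop, which is where the remaining rounds
    -- start.
    obtain ⟨v₁, t₁, ht₁, h₁⟩ := ihb (fun l => emb (some ⟨a, l⟩)) (emb none)
      (fun l => hM (some ⟨a, l⟩)) (update v k (some a))
    obtain ⟨v₂, t₂, ht₂, h₂⟩ := ihl emb exit hM v₁
    refine ⟨v₂, t₂ + (t₁ + 1), by omega, ?_⟩
    rw [iterate_add_apply, iterate_succ_apply]
    have h₀ : flip bind (TM2.step M) (some ⟨some (emb (start (.loop k body))), v, S⟩) =
        some ⟨some (emb (some ⟨a, (body a).start⟩)), update v k (some a), update S k l⟩ := by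
      simp [flip, hn, start, popGoto, hS]
    rw [h₀, h₁]
    exact h₂
  | @test k body S S' t _ ih =>
    intro emb exit hM v
    obtain ⟨f, hf⟩ : ∃ f : Option (Γ k) → Λ, f = fun o => emb (some ⟨o, (body o).start⟩) := ⟨_, rfl⟩
    have hn : M (emb none) = popGoto k f := hf ▸ hM none
    obtain ⟨v₁, t₁, ht₁, h₁⟩ := ih (fun l => emb (some ⟨_, l⟩)) exit
      (fun l => hM (some ⟨_, l⟩)) (update v k (S k).head?)
    refine ⟨v₁, t₁ + 1, by omega, ?_⟩
    have h₀ : flip bind (TM2.step M) (some ⟨some (emb (start (.test k body))), v, S⟩) =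
        some ⟨some (f (S k).head?), update v k (S k).head?, update S k (S k).tail⟩ := by
      simp [flip, hn, start, popGoto]
    rw [iterate_succ_apply, ← h₁, h₀, hf]
  | weaken _ hle ih =>
    intro emb exit hM v
    obtain ⟨v', t', ht', h⟩ := ih emb exit hM v
    exact ⟨v', t', ht'.trans hle, h⟩

/-- The machine that runs a program. -/
noncomputable def machine [Fintype K] [∀ k, Finite (Γ k)] (k₀ k₁ : K) (p : Prog Γ) : FinTM2 :=
  have := p.finite_lab
  { K := K
    k₀ := k₀
    k₁ := k₁
    Γ := Γ
    Λ := Option p.Lab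
    main := some p.start
    ΛFin := Fintype.ofFinite _
    σ := ∀ k, Option (Γ k)
    initialState := fun _ => none
    σFin := Fintype.ofFinite _
    Γk₀Fin := Fintype.ofFinite _
    m := fun l => l.elim (.load (fun _ _ => none) .halt) (p.code some none) }

/-- The left side is the form in which `initList` and `haltList` describe the stacks. -/
theorem dite_eq_update (k₀ : K) (x : List (Γ k₀)) :
    (fun k => @dite (List (Γ k)) (k = k₀) (inferInstance) (fun h => by rw [h]; exact x)
      fun _ => []) =
      update (fun _ => []) k₀ x := by
  funext k
  by_cases hk : k = k₀
  · subst hk; simp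
  · simp [hk]

theorem Runs.machine_outputs [Fintype K] [∀ k, Finite (Γ k)] {k₀ k₁ : K} {p : Prog Γ}
    {x : List (Γ k₀)} {y : List (Γ k₁)} {t : ℕ}
    (h : Runs p (update (fun _ => []) k₀ x) (update (fun _ => []) k₁ y) t) :
    Nonempty (TM2OutputsInTime (machine k₀ k₁ p) x (some y) (t + 1)) := by
  obtain ⟨v, t', ht', hr⟩ := h.reaches (M := (machine k₀ k₁ p).m) some none
    (fun l => rfl) (fun _ => none)
  -- The additional step is taken at the exit label: it resets the memory to its initial value, as
  -- `haltList` demands, and halts.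
  refine ⟨⟨⟨t' + 1, ?_⟩, Nat.succ_le_succ ht'⟩⟩
  have h₀ : initList (machine k₀ k₁ p) x =
      ⟨some (some p.start), fun _ => none, update (fun _ => []) k₀ x⟩ :=
    congrArg (TM2.Cfg.mk _ _) (dite_eq_update k₀ x)
  have h₁ : haltList (machine k₀ k₁ p) y =
      ⟨none, fun _ => none, update (fun _ => []) k₁ y⟩ :=
    congrArg (TM2.Cfg.mk _ _) (dite_eq_update k₁ y)
  have h₂ := congrArg (flip bind (TM2.step (machine k₀ k₁ p).m)) hr
  refine (congrArg (fun c => (flip bind (TM2.step (machine k₀ k₁ p).m))^[t' + 1] (some c)) h₀).trans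
    (((iterate_succ_apply' _ _ _).trans h₂).trans ?_)
  exact congrArg some h₁.symm

end Prog

end ParamComplexity

namespace ParamComplexity

/-! ### Circuits given by lists of gates -/

/-- The property `P` holds for all gates of a list, with the number of the wire of each gate. -/
def AllAt (P : ℕ → Gate → Prop) : ℕ → List Gate → Prop
  | _, [] => True
  | b, g :: gs => P b g ∧ AllAt P (b + 1) gs

section AllAt

variable {P : ℕ → Gate → Prop}

theorem allAt_append {b : ℕ} {l₁ l₂ : List Gate} :
    AllAt P b (l₁ ++ l₂) ↔ AllAt P b l₁ ∧ AllAt P (b + l₁.length) l₂ := by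
  induction l₁ generalizing b with
  | nil => simp [AllAt]
  | cons g l ih => simp [AllAt, ih, and_assoc, Nat.add_assoc, Nat.add_comm 1]

/-- All blocks have the same length `L`, so block `i` starts at wire `b + L * i`. -/
theorem allAt_range_flatMap {b L : ℕ} {f : ℕ → List Gate} (hf : ∀ i, (f i).length = L) (m : ℕ) :
    AllAt P b ((List.range m).flatMap f) ↔ ∀ i < m, AllAt P (b + L * i) (f i) := by
  induction m with
  | zero => simp [AllAt]
  | succ m ih =>
    have hl : ((List.range m).flatMap f).length = L * m := by
      simp [List.length_flatMap, hf, Nat.mul_comm]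
    rw [List.range_succ, List.flatMap_append, allAt_append, ih, hl, Nat.forall_lt_succ_right]
    simp

theorem allAt_range_map {b : ℕ} {g : ℕ → Gate} (n : ℕ) :
    AllAt P b ((List.range n).map g) ↔ ∀ j < n, P (b + j) (g j) := by
  have h := allAt_range_flatMap (P := P) (b := b) (f := fun j => [g j]) (L := 1) (fun _ => rfl) n
  rw [List.map_eq_flatMap]
  simpa [AllAt] using h

theorem allAt_getElem {b : ℕ} {gs : List Gate} (h : AllAt P b gs) (i : ℕ) (hi : i < gs.length) :
    P (b + i) gs[i] := by
  induction gs generalizing b i with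
  | nil => simp at hi
  | cons g gs ih =>
    cases i with
    | zero => exact h.1
    | succ i => simpa [Nat.add_assoc, Nat.add_comm 1] using ih h.2 i (by simpa using hi)

theorem allAt_of_getElem {b : ℕ} {gs : List Gate}
    (h : ∀ (i : ℕ) (hi : i < gs.length), P (b + i) gs[i]) : AllAt P b gs := by
  induction gs generalizing b with
  | nil => trivial
  | cons g gs ih =>
    refine ⟨h 0 (by simp), ih fun i hi => ?_⟩
    have := h (i + 1) (by simpa using hi)
    rwa [show b + (i + 1) = b + 1 + i by omega] at this

end AllAt

/-- Every gate reads only wires of smaller number. -/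
abbrev Topological : ℕ → List Gate → Prop :=
  AllAt fun w g => ∀ a ∈ g.args, a < w

/-- The wires carry the values of the gates. -/
abbrev Consistent (v : ℕ → Bool) : ℕ → List Gate → Prop :=
  AllAt fun w g => v w = g.eval v

theorem Gate.eval_congr {v v' : ℕ → Bool} (g : Gate) (h : ∀ a ∈ g.args, v a = v' a) :
    g.eval v = g.eval v' := by
  cases g with
  | conj l =>
    rw [Bool.eq_iff_iff, Gate.eval, Gate.eval, List.all_eq_true, List.all_eq_true]
    exact forall₂_congr fun a ha => by rw [h a ha]
  | disj l =>
    rw [Bool.eq_iff_iff, Gate.eval, Gate.eval, List.any_eq_true, List.any_eq_true]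
    exact exists_congr fun a => and_congr_right fun ha => by rw [h a ha]
  | neg a => simpa [Gate.eval] using h a (by simp [Gate.args])

/-- A gate is evaluated on the wires known so far, whereas consistency refers to the final list.
Both give the same value, because the gate reads only positions in the prefix and later appends
leave these alone. -/
theorem consistent_foldl (gs : List Gate) (w : List Bool) (h : Topological w.length gs) :
    ∃ t, gs.foldl (fun w g => w ++ [g.eval (fun i => w.getD i false)]) w = w ++ t ∧
      Consistent (fun i => (w ++ t).getD i false) w.length gs := by
  induction gs generalizing w with
  | nil => exact ⟨[], by simp, trivial⟩
  | cons g gs ih =>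
    obtain ⟨t, ht, hc⟩ := ih (w ++ [g.eval fun i => w.getD i false]) (by simpa using h.2)
    refine ⟨_ :: t, by rw [List.foldl_cons, ht, List.append_assoc]; rfl, ?_, ?_⟩
    · have e : ∀ a ∈ g.args, w.getD a false =
          (w ++ g.eval (fun i => w.getD i false) :: t).getD a false := by
        intro a ha
        have := h.1 a ha
        simp [List.getElem?_append_left this]
      simpa using g.eval_congr e
    · simpa using hc

theorem Circuit.topological (C : Circuit) : Topological C.numInputs C.gates :=
  allAt_of_getElem C.acyclic

theorem Circuit.wires_spec (C : Circuit) (x : Fin C.numInputs → Bool) :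
    (∀ i : Fin C.numInputs, (C.wires x).getD i false = x i) ∧
      Consistent (fun i => (C.wires x).getD i false) C.numInputs C.gates := by
  obtain ⟨t, ht, hc⟩ := consistent_foldl C.gates (List.ofFn x) (by simpa using C.topological)
  unfold Circuit.wires
  rw [ht]
  refine ⟨fun i => ?_, by simpa using hc⟩
  simp [List.getElem?_append_left]

/-! ### The circuit of a set family -/

/-- The wire `y` of the element, as covered so far, joined with the set on wire `x` if the element
belongs to that set. -/
def coverGate (y x : ℕ) (b : Bool) : Gate :=
  .disj (y :: if b then [x] else [])

/-- The gates that tell which of `n` elements are covered by the first `i` of `m` sets.  The previous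
row of gates starts at wire `y`, the sets start at wire `x`. -/
def coverGates (mem : ℕ → ℕ → Bool) (n m y x : ℕ) : List Gate :=
  (List.range m).flatMap fun i => (List.range n).map fun j =>
    coverGate (y + (n * i + j)) (x + i) (mem i j)

/-- Two gates of a constant value. -/
def constCell (b : Bool) : List Gate :=
  if b then [.conj [], .conj []] else [.disj [], .disj []]

/-- Given that `a + 1` and `a + 3` tell whether two neighbouring thresholds have been reached before
the element on wire `y`, the second gate tells whether the first of them is reached with it. -/
def countCell (y a w : ℕ) : List Gate :=
  [.conj [y, a + 3], .disj [a + 1, w]]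

/-- The thresholds reached before all elements: those that are at least `u`. -/
def initGates (n u : ℕ) : List Gate :=
  (List.range (n + 2)).flatMap fun d => constCell (decide (u ≤ d))

/-- The gates that count the true wires among `y, …, y + n - 1`; the initial thresholds start at
wire `a`. -/
def countGates (n y a : ℕ) : List Gate :=
  (List.range n).flatMap fun j => (List.range (n + 2)).flatMap fun d =>
    countCell (y + j) (a + 2 * ((n + 2) * j + d)) (a + 2 * ((n + 2) * j + d) + 2 * (n + 2))

theorem length_constCell (b : Bool) : (constCell b).length = 2 := by
  cases b <;> rfl

theorem length_coverGates (mem : ℕ → ℕ → Bool) (n m y x : ℕ) :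
    (coverGates mem n m y x).length = n * m := by
  simp [coverGates, List.length_flatMap, Nat.mul_comm]

theorem length_initGates (n u : ℕ) : (initGates n u).length = 2 * (n + 2) := by
  simp [initGates, List.length_flatMap, length_constCell, Nat.mul_comm]

theorem length_countGates (n y a : ℕ) : (countGates n y a).length = 2 * (n + 2) * n := by
  simp [countGates, countCell, List.length_flatMap, Nat.mul_comm]

theorem allAt_coverGates {P : ℕ → Gate → Prop} {mem : ℕ → ℕ → Bool} {b n m y x : ℕ} :
    AllAt P b (coverGates mem n m y x) ↔ ∀ i < m, ∀ j < n,
      P (b + n * i + j) (coverGate (y + (n * i + j)) (x + i) (mem i j)) := by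
  rw [coverGates, allAt_range_flatMap (L := n) (by simp)]
  simp only [allAt_range_map]

theorem allAt_initGates {P : ℕ → Gate → Prop} {b n u : ℕ} :
    AllAt P b (initGates n u) ↔ ∀ d < n + 2, AllAt P (b + 2 * d) (constCell (decide (u ≤ d))) := by
  rw [initGates, allAt_range_flatMap fun _ => length_constCell _]

theorem allAt_countGates {P : ℕ → Gate → Prop} {b n y a : ℕ} :
    AllAt P b (countGates n y a) ↔ ∀ j < n, ∀ d < n + 2,
      AllAt P (b + 2 * ((n + 2) * j + d)) (countCell (y + j) (a + 2 * ((n + 2) * j + d))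
        (a + 2 * ((n + 2) * j + d) + 2 * (n + 2))) := by
  rw [countGates, allAt_range_flatMap (L := 2 * (n + 2)) (fun j => by
    simp [countCell, List.length_flatMap, Nat.mul_comm])]
  refine forall₂_congr fun j _ => ?_
  rw [allAt_range_flatMap (L := 2) fun _ => rfl]
  refine forall₂_congr fun d _ => ?_
  rw [show b + 2 * (n + 2) * j + 2 * d = b + 2 * ((n + 2) * j + d) by ring]

/-- The gates of the circuit that checks whether at least `u` of `n` elements are covered by those
of the `m` sets that are selected on the wires `k + 1, …, k + m`. -/
def thresholdCoverGates (mem : ℕ → ℕ → Bool) (n m k u : ℕ) : List Gate :=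
  List.replicate n (.disj []) ++ (coverGates mem n m (k + 1 + m) (k + 1) ++ (initGates n u ++
    countGates n (k + 1 + m + n * m) (k + 1 + m + n * m + n)))

theorem length_thresholdCoverGates (mem : ℕ → ℕ → Bool) (n m k u : ℕ) :
    (thresholdCoverGates mem n m k u).length = n + (n * m + (2 * (n + 2) + 2 * (n + 2) * n)) := by
  simp [thresholdCoverGates, length_coverGates, length_initGates, length_countGates]

theorem allAt_thresholdCoverGates {P : ℕ → Gate → Prop} {mem : ℕ → ℕ → Bool} {n m k u : ℕ} :
    AllAt P (k + 1 + m) (thresholdCoverGates mem n m k u) ↔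
      AllAt P (k + 1 + m) (List.replicate n (.disj [])) ∧
      AllAt P (k + 1 + m + n) (coverGates mem n m (k + 1 + m) (k + 1)) ∧
      AllAt P (k + 1 + m + n * m + n) (initGates n u) ∧
      AllAt P (k + 1 + m + n * m + n + 2 * (n + 2))
        (countGates n (k + 1 + m + n * m) (k + 1 + m + n * m + n)) := by
  rw [thresholdCoverGates, allAt_append, allAt_append, allAt_append, length_coverGates,
    length_initGates, List.length_replicate, Nat.add_right_comm _ n (n * m)]

theorem topological_thresholdCoverGates (mem : ℕ → ℕ → Bool) (n m k u : ℕ) :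
    Topological (k + 1 + m) (thresholdCoverGates mem n m k u) := by
  refine allAt_thresholdCoverGates.2 ⟨?_, ?_, ?_, ?_⟩
  · refine allAt_of_getElem fun i hi => ?_
    simp [Gate.args]
  · refine allAt_coverGates.2 fun i hi j hj => ?_
    intro a ha
    simp only [coverGate, Gate.args, List.mem_cons] at ha
    rcases ha with rfl | ha
    · omega
    · split_ifs at ha <;> simp at ha
      omega
  · refine allAt_initGates.2 fun d _ => ?_
    unfold constCell
    split_ifs <;> simp [AllAt, Gate.args]
  -- In the last column `d = n + 1` the third wire after the start of the old cell already belongs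
  -- to the new row. It is still smaller than the gate that reads it, which lies `2 * (n + 2)` wires
  -- after that start.
  · refine allAt_countGates.2 fun j hj d hd => ?_
    simp only [AllAt, countCell, Gate.args, List.mem_cons, List.not_mem_nil, or_false,
      forall_eq_or_imp,
      forall_eq, and_true]
    have : j < n + 2 := by omega
    refine ⟨⟨by omega, by omega⟩, by omega, by omega⟩

/-- The circuit that checks whether at least `p` of `n` elements are covered. -/
def thresholdCoverCircuit (mem : ℕ → ℕ → Bool) (n m k u : ℕ) : Circuit where
  -- Wires `0, …, k` are padding. For the weight `k` of them would do; with one more, the program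
  -- can start its set counter at `k` and raise it at each set mark before using it.
  numInputs := k + 1 + m
  gates := thresholdCoverGates mem n m k u
  -- The second gate of the cell for `d = 0` in the last row of thresholds, after all `n` elements.
  output := k + 1 + m + n * m + n + 2 * (n + 2) * n + 1
  acyclic := fun i hi =>
    allAt_getElem (topological_thresholdCoverGates mem n m k u) i hi
  output_lt := by rw [length_thresholdCoverGates]; omega

/-- Two inductions along the rows: `cov` over the sets used so far, `hcount` over the elements
counted so far. The output is the case `l = n`, `d = 0` of the latter. -/
theorem thresholdCoverGates_value {mem : ℕ → ℕ → Bool} {n m k u : ℕ} (hu : u ≤ n + 1)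
    {v : ℕ → Bool} (h : Consistent v (k + 1 + m) (thresholdCoverGates mem n m k u)) :
    v (k + 1 + m + n * m + n + 2 * (n + 2) * n + 1) = true ↔
      u ≤ ((Finset.range n).filter fun j => ∃ i < m, mem i j = true ∧ v (k + 1 + i) = true).card := by
  obtain ⟨h₀, hc, hi, ht⟩ := allAt_thresholdCoverGates.1 h
  have h₀' : ∀ j < n, v (k + 1 + m + j) = false := by
    intro j hj
    have e := allAt_getElem h₀ j (by simpa using hj)
    rw [List.getElem_replicate] at e
    exact e
  have hc' := allAt_coverGates.1 hc
  -- Row `0` consists of empty disjunctions, which are false: no sets cover nothing.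
  have cov : ∀ l ≤ m, ∀ j < n, (v (k + 1 + m + n * l + j) = true ↔
      ∃ i < l, mem i j = true ∧ v (k + 1 + i) = true) := by
    intro l hl
    induction l with
    | zero => intro j hj; simp [h₀' j hj]
    | succ l ih =>
      intro j hj
      have e := hc' l (by omega) j hj
      rw [show k + 1 + m + n * (l + 1) + j = k + 1 + m + n + n * l + j by ring, e]
      have ih' := ih (by omega) j hj
      rw [Nat.add_assoc] at ih'
      simp only [coverGate, Gate.eval, List.any_cons, Bool.or_eq_true, ih']
      constructor
      · rintro (⟨i, hi, h⟩ | h)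
        · exact ⟨i, by omega, h⟩
        · refine ⟨l, by omega, ?_⟩
          split_ifs at h with hm <;> simp_all
      · rintro ⟨i, hi, hm, hv⟩
        rcases Nat.lt_succ_iff_lt_or_eq.1 hi with hi | rfl
        · exact Or.inl ⟨i, hi, hm, hv⟩
        · right; simp [hm, hv]
  have hcov := cov m le_rfl
  set y := k + 1 + m + n * m
  have hinit : ∀ d < n + 2, (v (y + n + 2 * d + 1) = true ↔ u ≤ d) := by
    intro d hd
    have := allAt_initGates.1 hi d hd
    unfold constCell at this
    split_ifs at this with hd' <;> simp [AllAt, Gate.eval] at this <;> simp_all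
  -- The offset `d` stands for elements granted in advance. A covered element passes the task from
  -- column `d` to column `d + 1` of the previous row.
  have hcount : ∀ l ≤ n, ∀ d < n + 2, (v (y + n + 2 * ((n + 2) * l + d) + 1) = true ↔
      u ≤ d + ((Finset.range l).filter fun j => v (y + j) = true).card) := by
    intro l hl
    induction l with
    | zero => intro d hd; simpa using hinit d hd
    | succ l ih =>
      intro d hd
      obtain ⟨e₁, e₂, -⟩ := allAt_countGates.1 ht l (by omega) d hd
      rw [show y + n + 2 * ((n + 2) * (l + 1) + d) + 1 =
        y + n + 2 * (n + 2) + 2 * ((n + 2) * l + d) + 1 by ring, e₂]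
      have hw : y + n + 2 * ((n + 2) * l + d) + 2 * (n + 2) =
        y + n + 2 * (n + 2) + 2 * ((n + 2) * l + d) := by ring
      have ih₁ := ih (by omega) d hd
      simp only [Gate.eval, List.any_cons, List.any_nil, Bool.or_false, Bool.or_eq_true, ih₁, hw, e₁,
        List.all_cons, List.all_nil, Bool.and_true, Bool.and_eq_true]
      rw [Finset.range_add_one, Finset.filter_insert]
      split_ifs with hv
      · rw [Finset.card_insert_of_notMem (by simp)]
        simp only [hv, true_and]
        -- The last column has no right neighbour; the wire read there belongs to the next row and
        -- has an unrelated meaning. This is harmless, as `u ≤ n + 1 = d` makes both sides true.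
        by_cases hd' : d = n + 1
        · constructor
          · intro _; omega
          · intro _; left; omega
        · have ih₂ := ih (by omega) (d + 1) (by omega)
          rw [show y + n + 2 * ((n + 2) * l + (d + 1)) + 1 = y + n + 2 * ((n + 2) * l + d) + 3 by ring]
            at ih₂
          rw [ih₂]
          omega
      · simp [hv]
  have := hcount n le_rfl 0 (by omega)
  rw [Nat.zero_add, show y + n + 2 * ((n + 2) * n + 0) + 1 = y + n + 2 * (n + 2) * n + 1 by ring] at this
  rw [this]
  refine Eq.to_iff (congrArg (fun s : Finset ℕ => u ≤ s.card) (Finset.filter_congr fun j hj => ?_))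
  exact hcov j (Finset.mem_range.1 hj)

/-- The membership matrix of a set family. -/
def SetFamily.mem (I : SetFamily) (i j : ℕ) : Bool :=
  if h : i < I.m ∧ j < I.n then decide ((⟨j, h.2⟩ : Fin I.n) ∈ I.S ⟨i, h.1⟩) else false

/-- The circuit of a set family. -/
def SetFamily.circuit (I : SetFamily) (k : ℕ) : Circuit :=
  thresholdCoverCircuit I.mem I.n I.m k (min I.p (I.n + 1))

theorem SetFamily.circuit_eval (I : SetFamily) (k : ℕ) (x : Fin (k + 1 + I.m) → Bool) :
    (I.circuit k).eval x = true ↔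
      I.p ≤ (({i | x (Fin.natAdd (k + 1) i) = true} : Finset (Fin I.m)).biUnion I.S).card := by
  obtain ⟨hx, hc⟩ := (I.circuit k).wires_spec x
  have hv := thresholdCoverGates_value (min_le_right _ _) hc
  refine (Iff.trans Iff.rfl hv).trans ?_
  have hcard : ((Finset.range I.n).filter fun j => ∃ i < I.m, I.mem i j = true ∧
      ((I.circuit k).wires x).getD (k + 1 + i) false = true) =
      (({i | x (Fin.natAdd (k + 1) i) = true} : Finset (Fin I.m)).biUnion I.S).map
        Fin.valEmbedding := by
    ext j
    simp only [Finset.mem_filter, Finset.mem_range, Finset.mem_map, Finset.mem_biUnion,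
      Finset.mem_univ, true_and, Fin.valEmbedding_apply]
    have hx' : ∀ i : Fin I.m, ((I.circuit k).wires x).getD (k + 1 + i) false =
      x (Fin.natAdd (k + 1) i) := fun i => hx (Fin.natAdd (k + 1) i)
    constructor
    · rintro ⟨hj, i, hi, hm, hw⟩
      refine ⟨⟨j, hj⟩, ⟨⟨i, hi⟩, ?_, ?_⟩, rfl⟩
      · rw [← hx' ⟨i, hi⟩]; exact hw
      · simpa [SetFamily.mem, hi, hj] using hm
    · rintro ⟨j, ⟨i, hi, hm⟩, rfl⟩
      exact ⟨j.2, i, i.2, by simpa [SetFamily.mem] using hm, (hx' i).trans hi⟩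
  rw [hcard, Finset.card_map]
  -- At most `n` elements can be covered, so capping `p` at `n + 1` does not change the condition.
  have := Finset.card_le_univ
    (({i | x (Fin.natAdd (k + 1) i) = true} : Finset (Fin I.m)).biUnion I.S)
  rw [Fintype.card_fin] at this
  omega

theorem card_filter_fin_add {a b : ℕ} (x : Fin (a + b) → Bool) :
    (Finset.univ.filter fun i => x i = true).card =
      (Finset.univ.filter fun i => x (Fin.castAdd b i) = true).card +
      (Finset.univ.filter fun i => x (Fin.natAdd a i) = true).card := by
  simp only [Finset.card_filter, Fin.sum_univ_add]

/-- Forwards, `k - T.card` true padding inputs bring the weight to exactly `k`. Backwards,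
forgetting the padding can only lower the weight. -/
theorem SetFamily.circuit_correct (I : SetFamily) (k : ℕ) :
    (∃ T : Finset (Fin I.m), T.card ≤ k ∧ I.p ≤ (T.biUnion I.S).card) ↔
      ∃ x : Fin (k + 1 + I.m) → Bool,
        (Finset.univ.filter fun i => x i = true).card = k ∧ (I.circuit k).eval x = true := by
  constructor
  · rintro ⟨T, hT, hp⟩
    refine ⟨Fin.append (fun i => decide ((i : ℕ) < k - T.card)) fun i => decide (i ∈ T), ?_, ?_⟩
    · rw [card_filter_fin_add]
      simp only [Fin.append_left, Fin.append_right, decide_eq_true_eq, Finset.filter_univ_mem]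
      have : (Finset.univ.filter fun i : Fin (k + 1) => (i : ℕ) < k - T.card).card =
          k - T.card := by
        rw [Fin.card_filter_val_lt]
        omega
      omega
    · rw [I.circuit_eval]
      simpa using hp
  · rintro ⟨x, hk, hx⟩
    rw [I.circuit_eval] at hx
    refine ⟨_, ?_, hx⟩
    rw [card_filter_fin_add] at hk
    omega

end ParamComplexity

namespace ParamComplexity

open Function

/-! ### The stacks of the reduction -/

/-- The counters, stacks that hold unary numbers. -/
inductive Ctr where
  | n | m | k | u | r | w | x | y | a | v | s | t
  deriving DecidableEq

instance : Fintype Ctr :=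
  ⟨{.n, .m, .k, .u, .r, .w, .x, .y, .a, .v, .s, .t}, by intro i; cases i <;> decide⟩

/-- The stacks. -/
inductive Stk where
  | inp | out | gates | mat | rows | pbits | kbits | ctr (c : Ctr)
  deriving DecidableEq, Fintype

/-- The alphabets of the stacks. -/
def Alph : Stk → Type
  | .inp => FamilySym ⊕ Bool
  | .out => CircuitSym ⊕ Bool
  | .gates => CircuitSym
  | .mat => FamilySym
  | .rows => FamilySym
  | .pbits => Bool
  | .kbits => Bool
  | .ctr _ => Unit

instance (k : Stk) : Finite (Alph k) := by
  cases k <;> unfold Alph <;> infer_instance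

/-- The contents of the stacks. -/
@[ext] structure St where
  inp : List (FamilySym ⊕ Bool)
  out : List (CircuitSym ⊕ Bool)
  gates : List CircuitSym
  mat : List FamilySym
  rows : List FamilySym
  pbits : List Bool
  kbits : List Bool
  c : Ctr → ℕ

namespace St

/-- The contents of the stacks, as a function. -/
def store (s : St) : ∀ k, List (Alph k)
  | .inp => s.inp
  | .out => s.out
  | .gates => s.gates
  | .mat => s.mat
  | .rows => s.rows
  | .pbits => s.pbits
  | .kbits => s.kbits
  | .ctr c => List.replicate (s.c c) ()

/-- Set a counter. -/
def set (s : St) (i : Ctr) (v : ℕ) : St :=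
  { s with c := update s.c i v }

/-- Append to the list of gates, which is kept in reversed order. -/
def emit (s : St) (l : List CircuitSym) : St :=
  { s with gates := l.reverse ++ s.gates }

variable (s : St)

theorem update_inp (l : List (FamilySym ⊕ Bool)) :
    update s.store .inp l = { s with inp := l }.store := by
  funext k; cases k <;> rfl

theorem update_out (l : List (CircuitSym ⊕ Bool)) :
    update s.store .out l = { s with out := l }.store := by
  funext k; cases k <;> rfl

theorem update_gates (l : List CircuitSym) :
    update s.store .gates l = { s with gates := l }.store := by
  funext k; cases k <;> rfl

theorem update_mat (l : List FamilySym) : update s.store .mat l = { s with mat := l }.store := by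
  funext k; cases k <;> rfl

theorem update_rows (l : List FamilySym) : update s.store .rows l = { s with rows := l }.store := by
  funext k; cases k <;> rfl

theorem update_pbits (l : List Bool) : update s.store .pbits l = { s with pbits := l }.store := by
  funext k; cases k <;> rfl

theorem update_kbits (l : List Bool) : update s.store .kbits l = { s with kbits := l }.store := by
  funext k; cases k <;> rfl

theorem update_ctr (i : Ctr) (v : ℕ) :
    update s.store (.ctr i) (List.replicate v ()) = (s.set i v).store := by
  funext k
  cases k with
  | ctr j =>
    by_cases h : j = i
    · subst h; simp [store, set]
    · have : Stk.ctr j ≠ Stk.ctr i := by simpa using h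
      simp [store, set, h, this]
  | _ => rfl

end St

/-! ### Programs on these stacks -/

abbrev P := Prog Alph

/-- `Exec p s s' t`: the program `p` leads from `s` to `s'` in at most `t` steps. -/
def Exec (p : P) (s s' : St) (t : ℕ) : Prop :=
  p.Runs s.store s'.store t

/-- Run several programs one after another. -/
def block : List P → P
  | [] => .skip
  | p :: l => .seq p (block l)

/-- Add one to a counter. -/
def inc (i : Ctr) : P :=
  .push (.ctr i) ()

/-- Empty a counter, running a program as many times as it says. -/
def each (i : Ctr) (body : P) : P :=
  .loop (.ctr i) fun _ => body

/-- Run a program as many times as the counter `i` says; the counter `j` is used to restore it. -/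
def keep (i j : Ctr) (body : P) : P :=
  .seq (each i (.seq (inc j) body)) (each j (inc i))

/-- Add the counter `i` to the counter `j`. -/
def addTo (i j : Ctr) : P :=
  keep i .t (inc j)

/-- Write the number of a wire. -/
def emitNum (i : Ctr) : P :=
  .seq (.push .gates CircuitSym.arg) (keep i .t (.push .gates CircuitSym.one))

theorem Exec.mono {p : P} {s s' s'' : St} {t t' : ℕ} (h : Exec p s s' t) (hs : s' = s'')
    (ht : t ≤ t') : Exec p s s'' t' :=
  hs ▸ Prog.Runs.weaken h ht

theorem exec_skip (s : St) : Exec .skip s s 1 :=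
  .skip _

theorem exec_seq {p q : P} {s s' s'' : St} {t t' : ℕ} (h : Exec p s s' t) (h' : Exec q s' s'' t') :
    Exec (.seq p q) s s'' (t + t') :=
  .seq h h'

theorem exec_nil (s : St) : Exec (block []) s s 1 :=
  .skip _

theorem exec_cons {p : P} {l : List P} {s s' s'' : St} {t t' : ℕ} (h : Exec p s s' t)
    (h' : Exec (block l) s' s'' t') : Exec (block (p :: l)) s s'' (t + t') :=
  .seq h h'

theorem exec_push {k : Stk} (b : Alph k) {s s' : St}
    (h : update s.store k (b :: s.store k) = s'.store) : Exec (.push k b) s s' 1 := by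
  unfold Exec
  rw [← h]
  exact .push _ _ _

theorem exec_inc (i : Ctr) (s : St) : Exec (inc i) s (s.set i (s.c i + 1)) 1 :=
  exec_push (k := .ctr i) () (s.update_ctr i (s.c i + 1))

theorem exec_push_out (b : CircuitSym ⊕ Bool) (s : St) :
    Exec (.push .out b) s { s with out := b :: s.out } 1 :=
  exec_push (k := .out) b (s.update_out _)

theorem exec_push_gates (b : CircuitSym) (s : St) :
    Exec (.push .gates b) s (s.emit [b]) 1 :=
  exec_push (k := .gates) b (s.update_gates _)

theorem exec_push_mat (b : FamilySym) (s : St) :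
    Exec (.push .mat b) s { s with mat := b :: s.mat } 1 :=
  exec_push (k := .mat) b (s.update_mat _)

theorem exec_push_rows (b : FamilySym) (s : St) :
    Exec (.push .rows b) s { s with rows := b :: s.rows } 1 :=
  exec_push (k := .rows) b (s.update_rows _)

theorem exec_push_pbits (b : Bool) (s : St) :
    Exec (.push .pbits b) s { s with pbits := b :: s.pbits } 1 :=
  exec_push (k := .pbits) b (s.update_pbits _)

theorem exec_push_kbits (b : Bool) (s : St) :
    Exec (.push .kbits b) s { s with kbits := b :: s.kbits } 1 :=
  exec_push (k := .kbits) b (s.update_kbits _)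

theorem exec_loop_nil {k : Stk} {body : Alph k → P} {s : St} (h : s.store k = []) :
    Exec (.loop k body) s s 1 :=
  .loop_nil h

theorem exec_loop_cons {k : Stk} {body : Alph k → P} {s s₁ s' s'' : St} {a : Alph k}
    {l : List (Alph k)} {t t' : ℕ} (h : s.store k = a :: l) (h₁ : update s.store k l = s₁.store)
    (hb : Exec (body a) s₁ s' t) (hl : Exec (.loop k body) s' s'' t') :
    Exec (.loop k body) s s'' (t + t' + 1) := by
  unfold Exec at hb
  rw [← h₁] at hb
  exact .loop_cons h hb hl

/-- `f l` is the state before round `l`. One symbol has been popped when the body starts, hence `N -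
(l + 1)` in `hb`. -/
theorem exec_each {i : Ctr} {body : P} (f : ℕ → St) (T N : ℕ) (h₀ : ∀ l ≤ N, (f l).c i = N - l)
    (hb : ∀ l < N, Exec body ((f l).set i (N - (l + 1))) (f (l + 1)) T) :
    Exec (each i body) (f 0) (f N) (N * (T + 1) + 1) := by
  induction N generalizing f with
  | zero =>
    rw [Nat.zero_mul, Nat.zero_add]
    exact exec_loop_nil (by simp [St.store, h₀ 0 le_rfl])
  | succ N ih =>
    have h := ih (fun l => f (l + 1)) (fun l hl => by rw [h₀ _ (by omega)]; omega)
      (fun l hl => by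
        have := hb (l + 1) (by omega)
        rwa [show N + 1 - (l + 1 + 1) = N - (l + 1) by omega] at this)
    refine Exec.mono (exec_loop_cons (k := .ctr i) (a := ()) (l := List.replicate N ()) ?_
      ((f 0).update_ctr i N) (by simpa using hb 0 (by omega)) h) rfl (by ring_nf; omega)
    change List.replicate ((f 0).c i) () = () :: List.replicate N ()
    rw [h₀ 0 (by omega)]
    rfl

/-- The rule for `each` with prescribed states and time. -/
theorem exec_each' {i : Ctr} {body : P} {s s' : St} {t : ℕ} (f : ℕ → St) (T N : ℕ) (hs : s = f 0)
    (hs' : f N = s') (ht : N * (T + 1) + 1 ≤ t) (h₀ : ∀ l ≤ N, (f l).c i = N - l)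
    (hb : ∀ l < N, Exec body ((f l).set i (N - (l + 1))) (f (l + 1)) T) :
    Exec (each i body) s s' t :=
  hs ▸ (exec_each f T N h₀ hb).mono hs' ht

/-- `f l` is the state after `l` rounds as it would be with counter `i` intact and `j` empty. During
the loop the content of `i` is split between `i` and `j`, so the body has to be verified with these
two counters overwritten. -/
theorem exec_keep {i j : Ctr} (hij : i ≠ j) {body : P} (f : ℕ → St) (T N : ℕ)
    (hi : ∀ l ≤ N, (f l).c i = N) (hj : ∀ l ≤ N, (f l).c j = 0)
    (hb : ∀ l < N, Exec body (((f l).set i (N - (l + 1))).set j (l + 1))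
      (((f (l + 1)).set i (N - (l + 1))).set j (l + 1)) T) :
    Exec (keep i j body) (f 0) (f N) (N * (T + 4) + 2) := by
  have h₁ : Exec (each i (.seq (inc j) body)) (f 0) (((f N).set i 0).set j N)
      (N * (1 + T + 1) + 1) := by
    refine exec_each' (fun l => ((f l).set i (N - l)).set j l) (1 + T) N ?_ (by simp) le_rfl ?_ ?_
    · ext1 <;> try rfl
      have h1 := hi 0 (Nat.zero_le _)
      have h2 := hj 0 (Nat.zero_le _)
      funext l'
      simp only [St.set, update_apply]
      split_ifs <;> simp_all
    · intro l _
      simp [St.set, hij]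
    · intro l hl
      refine exec_seq ((exec_inc j _).mono ?_ le_rfl) (hb l hl)
      ext1 <;> try rfl
      funext l'
      simp only [St.set, update_apply]
      split_ifs <;> simp_all
  have h₂ : Exec (each j (inc i)) (((f N).set i 0).set j N) (f N) (N * (1 + 1) + 1) := by
    refine exec_each' (fun l => ((f N).set i l).set j (N - l)) 1 N (by simp) ?_ le_rfl ?_ ?_
    · ext1 <;> try rfl
      have h1 := hi N le_rfl
      have h2 := hj N le_rfl
      funext l'
      simp only [St.set, update_apply]
      split_ifs <;> simp_all
    · intro l _
      simp [St.set]
    · intro l hl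
      refine (exec_inc i _).mono ?_ le_rfl
      ext1 <;> try rfl
      funext l'
      simp only [St.set, update_apply]
      split_ifs <;> simp_all
  exact (exec_seq h₁ h₂).mono rfl (by ring_nf; omega)

/-- The rule for `keep` with prescribed states and time. -/
theorem exec_keep' {i j : Ctr} (hij : i ≠ j) {body : P} {s s' : St} {t : ℕ} (f : ℕ → St) (T N : ℕ)
    (hs : s = f 0) (hs' : f N = s') (hst : N * (T + 4) + 2 ≤ t)
    (hi : ∀ l ≤ N, (f l).c i = N) (hj : ∀ l ≤ N, (f l).c j = 0)
    (hb : ∀ l < N, Exec body (((f l).set i (N - (l + 1))).set j (l + 1))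
      (((f (l + 1)).set i (N - (l + 1))).set j (l + 1)) T) :
    Exec (keep i j body) s s' t :=
  hs ▸ (exec_keep hij f T N hi hj hb).mono hs' hst

theorem exec_addTo {i j : Ctr} (hij : i ≠ j) (hi : i ≠ .t) (hj : j ≠ .t) {s : St}
    (ht : s.c .t = 0) : Exec (addTo i j) s (s.set j (s.c j + s.c i)) (5 * s.c i + 2) := by
  refine exec_keep' hi (fun l => s.set j (s.c j + l)) 1 (s.c i) (by simp [St.set]) rfl
    (by omega) ?_ ?_ ?_
  · intro l _; simp [St.set, hij]
  · intro l _; simp [St.set, hj.symm, ht]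
  · intro l hl
    refine (exec_inc j _).mono ?_ le_rfl
    ext1 <;> try rfl
    funext j
    simp only [St.set, update_apply]
    split_ifs <;> simp_all
    omega

theorem exec_emitNum {i : Ctr} (hi : i ≠ .t) {s : St} (ht : s.c .t = 0) :
    Exec (emitNum i) s (s.emit (.arg :: List.replicate (s.c i) .one)) (5 * s.c i + 3) := by
  refine (exec_seq (exec_push_gates _ s) (exec_keep' hi
    (fun l => s.emit (.arg :: List.replicate l .one)) 1 (s.c i) (by simp) rfl
    le_rfl (fun l _ => rfl) (fun l _ => ht) ?_)).mono rfl (by omega)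
  intro l hl
  refine (exec_push_gates _ _).mono ?_ le_rfl
  ext1 <;> try rfl
  simp [St.emit, St.set, List.replicate_succ']

end ParamComplexity

namespace ParamComplexity

open Function

/-! ### Reading the input -/

/-- Put one symbol of the input on the stack where it belongs. -/
def parseSym : FamilySym ⊕ Bool → P
  | .inl .elem => inc .n
  | .inl .target => .skip
  | .inl (.bit b) => .push .pbits b
  | .inl .set => .seq (inc .m) (.push .mat FamilySym.set)
  | .inl (.mem b) => .push .mat (FamilySym.mem b)
  | .inr b => .push .kbits b

/-- The effect of `parseSym`. -/
def parseStep (s : St) : FamilySym ⊕ Bool → St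
  | .inl .elem => s.set .n (s.c .n + 1)
  | .inl .target => s
  | .inl (.bit b) => { s with pbits := b :: s.pbits }
  | .inl .set => { s.set .m (s.c .m + 1) with mat := .set :: s.mat }
  | .inl (.mem b) => { s with mat := .mem b :: s.mat }
  | .inr b => { s with kbits := b :: s.kbits }

theorem exec_parseSym (a : FamilySym ⊕ Bool) (s : St) : Exec (parseSym a) s (parseStep s a) 2 := by
  rcases a with (_ | _ | b | _ | b) | b
  · exact (exec_inc _ _).mono rfl (by omega)
  · exact (exec_skip _).mono rfl (by omega)
  · exact (exec_push_pbits _ _).mono rfl (by omega)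
  · exact exec_seq (exec_inc _ _) (exec_push_mat _ _)
  · exact (exec_push_mat _ _).mono rfl (by omega)
  · exact (exec_push_kbits _ _).mono rfl (by omega)

theorem exec_parse (l : List (FamilySym ⊕ Bool)) (s : St) (hs : s.inp = l) :
    Exec (.loop .inp parseSym) s (l.foldl parseStep { s with inp := [] }) (3 * l.length + 1) := by
  induction l generalizing s with
  | nil => exact (exec_loop_nil (k := .inp) hs).mono (by ext1 <;> simp [hs]) (by simp)
  | cons a l ih =>
    refine (exec_loop_cons (k := .inp) hs (s.update_inp l) (exec_parseSym a _) (ih _ ?_)).mono ?_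
      (by simp; omega)
    · rcases a with (_ | _ | b | _ | b) | b <;> rfl
    · rw [List.foldl_cons]
      congr 1
      rcases a with (_ | _ | b | _ | b) | b <;> rfl

/-! ### Binary numbers -/

/-- Horner's rule. -/
def horner (u : ℕ) (b : Bool) : ℕ :=
  2 * u + b.toNat

/-- Intermediate values never exceed the final one, so a bound on the result bounds the time of
every doubling. -/
theorem le_foldl_horner (l : List Bool) (u : ℕ) : u ≤ l.foldl horner u := by
  induction l generalizing u with
  | nil => rfl
  | cons b l ih => exact (by unfold horner; omega : u ≤ horner u b).trans (ih _)

/-- Double the counter `k` and add a bit, which is copied to the output. -/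
def readParamBit (b : Bool) : P :=
  block [.push .out (.inr b : CircuitSym ⊕ Bool), each .k (block [inc .t, inc .t]),
    each .t (inc .k), if b = true then inc .k else .skip]

/-- Compute the parameter in unary, and copy it to the output. -/
def readParam : P :=
  .loop .kbits readParamBit

/-- The time is proportional to the value of the parameter, not to its length; only the parameter
can be expanded in this way. Copying to `out` while popping reverses the bits, which undoes the
reversal made by parsing. -/
theorem exec_readParam {B : ℕ} (l : List Bool) (s : St) (hs : s.kbits = l) (ht : s.c .t = 0)
    (hB : l.foldl horner (s.c .k) ≤ B) :
    Exec readParam s ({ s with kbits := [], out := (l.map Sum.inr).reverse ++ s.out }.set .k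
      (l.foldl horner (s.c .k))) (l.length * (8 * B + 6) + 1) := by
  induction l generalizing s with
  | nil =>
    refine (exec_loop_nil (k := .kbits) hs).mono ?_ (by simp)
    ext1 <;> simp [St.set, hs]
  | cons b l ih =>
    have hk : s.c .k ≤ B := (le_foldl_horner (b :: l) _).trans hB
    have h₁ : Exec (readParamBit b) { s with kbits := l }
        ({ s with kbits := l, out := .inr b :: s.out }.set .k (horner (s.c .k) b)) (8 * B + 5) := by
      refine (exec_cons (exec_push_out _ _) <| exec_cons
        (exec_each' (fun i => ({ s with kbits := l, out := .inr b :: s.out }.set .k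
          (s.c .k - i)).set .t (2 * i)) 3 (s.c .k) ?_ rfl le_rfl ?_ ?_) <| exec_cons
        (exec_each' (fun i => ({ s with kbits := l, out := .inr b :: s.out }.set .k i).set .t
          (2 * s.c .k - i)) 1 (2 * s.c .k) ?_ rfl le_rfl ?_ ?_) <| exec_cons
        (s' := ({ s with kbits := l, out := .inr b :: s.out }.set .k (horner (s.c .k) b)))
        (t := 1) ?_ <| exec_nil _).mono rfl (by omega)
      · refine St.ext rfl rfl rfl rfl rfl rfl rfl (funext fun i => ?_)
        cases i <;> simp [St.set, ht]
      · intro i _; simp [St.set]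
      · intro i hi
        refine (exec_cons (exec_inc _ _) <| exec_cons (exec_inc _ _) <| exec_nil _).mono ?_ le_rfl
        refine St.ext rfl rfl rfl rfl rfl rfl rfl (funext fun i => ?_)
        cases i <;> simp [St.set]; omega
      · refine St.ext rfl rfl rfl rfl rfl rfl rfl (funext fun i => ?_)
        cases i <;> simp [St.set]
      · intro i _; simp [St.set]
      · intro i hi
        refine (exec_inc _ _).mono ?_ le_rfl
        refine St.ext rfl rfl rfl rfl rfl rfl rfl (funext fun i => ?_)
        cases i <;> simp [St.set]
      · cases b
        · refine (exec_skip _).mono ?_ le_rfl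
          refine St.ext rfl rfl rfl rfl rfl rfl rfl (funext fun i => ?_)
          cases i <;> simp [St.set, horner, ht]
        · refine (exec_inc _ _).mono ?_ le_rfl
          refine St.ext rfl rfl rfl rfl rfl rfl rfl (funext fun i => ?_)
          cases i <;> simp [St.set, horner, ht]
    refine (exec_loop_cons (k := .kbits) hs (s.update_kbits l) h₁ (ih _ rfl ?_ ?_)).mono ?_ ?_
    · simpa [St.set] using ht
    · simpa [St.set] using hB
    · ext1 <;> simp [St.set]
    · simp only [List.length_cons]; ring_nf; omega

/-- Move one from the counter `r` to the counter `u`, if possible. -/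
def capInc : P :=
  .test (.ctr .r) fun o => o.elim .skip fun _ => inc .u

theorem exec_test {k : Stk} {body : Option (Alph k) → P} {s s₁ s' : St} {t : ℕ}
    (h₁ : update s.store k (s.store k).tail = s₁.store)
    (hb : Exec (body (s.store k).head?) s₁ s' t) : Exec (.test k body) s s' (t + 1) := by
  unfold Exec at hb
  rw [← h₁] at hb
  exact .test hb

theorem exec_capInc {R : ℕ} (s : St) (hR : s.c .u + s.c .r = R) :
    Exec capInc s ((s.set .u (min (s.c .u + 1) R)).set .r (R - min (s.c .u + 1) R)) 2 := by
  refine exec_test (s₁ := s.set .r (s.c .r - 1)) ?_ ?_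
  · rw [← s.update_ctr]
    congr 1
    exact List.tail_replicate
  · change Exec ((List.replicate (s.c .r) ()).head?.elim .skip fun _ => inc .u) _ _ _
    cases hr : s.c .r with
    | zero =>
      refine (exec_skip _).mono ?_ le_rfl
      refine St.ext rfl rfl rfl rfl rfl rfl rfl (funext fun i => ?_)
      cases i <;> simp [St.set] <;> omega
    | succ r =>
      refine (exec_inc _ _).mono ?_ le_rfl
      refine St.ext rfl rfl rfl rfl rfl rfl rfl (funext fun i => ?_)
      cases i <;> simp [St.set] <;> omega

/-- Double the counter `u` and add a bit, as far as there is room in the counter `r`. -/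
def readTargetBit (b : Bool) : P :=
  block [each .u (block [inc .t, inc .t, inc .r]), each .t capInc,
    if b = true then capInc else .skip]

/-- Compute the number of elements to be covered in unary, in the counter `u`, as far as there is
room in the counter `r`. -/
def readTarget : P :=
  .loop .pbits readTargetBit

/-- The number may be exponential in the input length, so its unary form is cut off at `R` all
along, with `r` holding the remaining room `R - u`. `h₀` is the Horner value without cut-off;
cutting off before doubling does not change the cut-off result. -/
theorem exec_readTarget {R h₀ : ℕ} (l : List Bool) (s : St) (hs : s.pbits = l) (ht : s.c .t = 0)
    (hu : s.c .u = min h₀ R) (hr : s.c .r = R - s.c .u) :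
    Exec readTarget s (({ s with pbits := [] }.set .u (min (l.foldl horner h₀) R)).set .r
      (R - min (l.foldl horner h₀) R)) (l.length * (11 * R + 6) + 1) := by
  induction l generalizing s h₀ with
  | nil =>
    refine (exec_loop_nil (k := .pbits) hs).mono ?_ (by simp)
    refine St.ext rfl rfl rfl rfl rfl hs rfl (funext fun i => ?_)
    cases i <;> simp [St.set, hu, hr]
  | cons b l ih =>
    have h₁ : Exec (readTargetBit b) { s with pbits := l }
        (({ s with pbits := l }.set .u (min (horner h₀ b) R)).set .r
          (R - min (horner h₀ b) R)) (11 * R + 5) := by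
      refine (exec_cons
        (exec_each' (fun i => (({ s with pbits := l }.set .u (s.c .u - i)).set .t (2 * i)).set .r
          (R - s.c .u + i)) 4 (s.c .u) ?_ rfl le_rfl ?_ ?_) <| exec_cons
        (exec_each' (fun i => (({ s with pbits := l }.set .u (min i R)).set .t
          (2 * s.c .u - i)).set .r (R - min i R)) 2 (2 * s.c .u) ?_ rfl le_rfl ?_ ?_) <| exec_cons
        (s' := (({ s with pbits := l }.set .u (min (horner h₀ b) R)).set .r
          (R - min (horner h₀ b) R)))
        (t := 2) ?_ <| exec_nil _).mono rfl (by omega)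
      · refine St.ext rfl rfl rfl rfl rfl rfl rfl (funext fun i => ?_)
        cases i <;> simp [St.set, ht, hr]
      · intro i _; simp [St.set]
      · intro i hi
        refine (exec_cons (exec_inc _ _) <| exec_cons (exec_inc _ _) <| exec_cons (exec_inc _ _) <|
          exec_nil _).mono ?_ le_rfl
        refine St.ext rfl rfl rfl rfl rfl rfl rfl (funext fun i => ?_)
        cases i <;> simp [St.set] <;> omega
      · refine St.ext rfl rfl rfl rfl rfl rfl rfl (funext fun i => ?_)
        cases i <;> simp [St.set] <;> omega
      · intro i _; simp [St.set]
      · intro i hi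
        refine (exec_capInc (R := R) _ ?_).mono ?_ le_rfl
        · simp [St.set]
        refine St.ext rfl rfl rfl rfl rfl rfl rfl (funext fun i => ?_)
        cases i <;> simp [St.set] <;> omega
      · cases b
        · refine (exec_skip _).mono ?_ (by omega)
          refine St.ext rfl rfl rfl rfl rfl rfl rfl (funext fun i => ?_)
          cases i <;> simp [St.set, horner, ht] <;> omega
        · refine (exec_capInc (R := R) _ ?_).mono ?_ le_rfl
          · simp [St.set]
          refine St.ext rfl rfl rfl rfl rfl rfl rfl (funext fun i => ?_)
          cases i <;> simp [St.set, horner, ht] <;> omega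
    refine (exec_loop_cons (k := .pbits) hs (s.update_pbits l) h₁
      (ih (h₀ := horner h₀ b) _ rfl ?_ ?_ ?_)).mono
      ?_ ?_
    · simpa [St.set] using ht
    · simp [St.set]
    · simp [St.set]
    · refine St.ext rfl rfl rfl rfl rfl rfl rfl (funext fun i => ?_)
      cases i <;> simp [St.set]
    · simp only [List.length_cons]; ring_nf; omega

/-- Reverse the list of the sets. -/
def reverseRows : P :=
  .loop .mat fun b => .push .rows b

theorem exec_reverseRows (l : List FamilySym) (s : St) (hs : s.mat = l) :
    Exec reverseRows s { s with mat := [], rows := l.reverse ++ s.rows } (2 * l.length + 1) := by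
  induction l generalizing s with
  | nil => exact (exec_loop_nil (k := .mat) hs).mono (by ext1 <;> simp [hs]) (by simp)
  | cons a l ih =>
    refine (exec_loop_cons (k := .mat) hs (s.update_mat l) (exec_push_rows a _) (ih _ rfl)).mono ?_
      (by simp; omega)
    simp

/-! ### Writing the gates -/

/-- The gates written for the description of the sets. -/
def coverWord : List FamilySym → ℕ → ℕ → List Gate
  | [], _, _ => []
  | .set :: l, y, x => coverWord l y (x + 1)
  | .mem b :: l, y, x => coverGate y x b :: coverWord l (y + 1) x
  | _ :: l, y, x => coverWord l y x

/-- The number of marks of sets. -/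
def numSets : List FamilySym → ℕ
  | [] => 0
  | .set :: l => numSets l + 1
  | _ :: l => numSets l

/-- The number of bits of characteristic vectors. -/
def numMems : List FamilySym → ℕ
  | [] => 0
  | .mem _ :: l => numMems l + 1
  | _ :: l => numMems l

/-- Write the gate for one symbol of the description of the sets. -/
def coverSym : FamilySym → P
  | .set => inc .x
  | .mem b => block [.push .gates CircuitSym.disj, emitNum .y,
      if b = true then emitNum .x else .skip, inc .w, inc .y]
  | _ => .skip

/-- Write the description of a list of gates. -/
def St.emitGates (s : St) (l : List Gate) : St :=
  s.emit (l.flatMap Gate.encode)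

/-- A membership bit advances both the next free wire `w` and the wire `y` that is read, so their
distance, one row, is kept and the same element of the previous row is met. `B` bounds the wire
numbers and thus the cost of writing them in unary. -/
theorem exec_cover {B : ℕ} (l : List FamilySym) (s : St) (hs : s.rows = l) (ht : s.c .t = 0)
    (hx : s.c .x + numSets l ≤ B) (hy : s.c .y + numMems l ≤ B) :
    Exec (.loop .rows coverSym) s ((((({ s with rows := [] }.emitGates
      (coverWord l (s.c .y) (s.c .x))).set .w (s.c .w + numMems l)).set .y
      (s.c .y + numMems l))).set .x (s.c .x + numSets l)) (l.length * (10 * B + 11) + 1) := by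
  induction l generalizing s with
  | nil =>
    refine (exec_loop_nil (k := .rows) hs).mono ?_ (by simp)
    ext1 <;> simp [St.set, St.emitGates, St.emit, coverWord, numSets, numMems, hs]
  | cons a l ih =>
    have time : ∀ t, t ≤ 10 * B + 10 →
        t + (l.length * (10 * B + 11) + 1) + 1 ≤ (a :: l).length * (10 * B + 11) + 1 := by
      intro t ht
      rw [List.length_cons, Nat.add_one_mul l.length]
      omega
    have hl := fun {s' s'' t t'} => @exec_loop_cons .rows coverSym s _ s' s'' a l t t' hs
      (s.update_rows l)
    rcases a with _ | _ | b | _ | b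
    · refine (hl (exec_skip _) (ih _ rfl ht hx hy)).mono rfl (time _ (by omega))
    · refine (hl (exec_skip _) (ih _ rfl ht hx hy)).mono rfl (time _ (by omega))
    · refine (hl (exec_skip _) (ih _ rfl ht hx hy)).mono rfl (time _ (by omega))
    · simp only [numSets, numMems] at hx hy
      refine (hl (exec_inc _ _) (ih _ rfl ?_ ?_ ?_)).mono ?_ (time _ (by omega))
      · simpa [St.set, St.emitGates, St.emit] using ht
      · simp [St.set]; omega
      · simp [St.set]; omega
      · refine St.ext rfl rfl rfl rfl rfl rfl rfl (funext fun i => ?_)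
        cases i <;> simp [St.set, St.emitGates, St.emit, numSets, numMems]; omega
    · simp only [numSets, numMems] at hx hy
      have h₁ : Exec (coverSym (.mem b)) { s with rows := l }
          ((({ s with rows := l }.emitGates [coverGate (s.c .y) (s.c .x) b]).set .w
            (s.c .w + 1)).set .y (s.c .y + 1)) (10 * B + 10) := by
        refine (exec_cons (exec_push_gates _ _) <|
          exec_cons (exec_emitNum (i := .y) (by decide) (by exact ht)) <|
          exec_cons (s' := { s with rows := l }.emitGates [coverGate (s.c .y) (s.c .x) b])
            (t := 5 * B + 3) ?_ <| exec_cons (exec_inc _ _) <| exec_cons (exec_inc _ _) <|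
            exec_nil _).mono ?_ ?_
        · cases b
          · refine (exec_skip _).mono ?_ (by omega)
            simp [St.emitGates, St.emit, coverGate, Gate.encode, encodeArgs]
          · refine (exec_emitNum (i := .x) (by decide) (by exact ht)).mono ?_ ?_
            · simp [St.emitGates, St.emit, coverGate, Gate.encode, encodeArgs]
            · simp [St.emit]; omega
        · ext1 <;> try rfl
        · simp [St.emit]; omega
      refine (hl h₁ (ih _ rfl ?_ ?_ ?_)).mono ?_ (time _ le_rfl)
      · simpa [St.set, St.emitGates, St.emit] using ht
      · simpa [St.set, St.emitGates, St.emit] using hx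
      · simp [St.set]; omega
      · refine St.ext rfl rfl ?_ rfl rfl rfl rfl (funext fun i => ?_)
        · simp [St.set, St.emitGates, St.emit, coverWord]
        · cases i <;> simp [St.set, St.emitGates, St.emit, numSets, numMems] <;> omega

/-- Write the gates for the elements that are covered by no set. -/
def writeBase : P :=
  keep .n .t (block [.push .gates CircuitSym.disj, inc .w])

theorem exec_writeBase (s : St) (ht : s.c .t = 0) :
    Exec writeBase s ((s.emitGates (List.replicate (s.c .n) (.disj []))).set .w
      (s.c .w + s.c .n)) (s.c .n * 7 + 2) := by
  refine exec_keep' (by decide) (fun l => (s.emitGates (List.replicate l (.disj []))).set .w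
      (s.c .w + l)) 3 (s.c .n) ?_ rfl le_rfl ?_ ?_ ?_
  · ext1 <;> simp [St.set, St.emitGates, St.emit]
  · intro l _; simp [St.set, St.emitGates, St.emit]
  · intro l _; simpa [St.set, St.emitGates, St.emit] using ht
  · intro l hl
    refine (exec_cons (exec_push_gates _ _) <| exec_cons (exec_inc _ _) <| exec_nil _).mono ?_ le_rfl
    refine St.ext rfl rfl ?_ rfl rfl rfl rfl (funext fun i => ?_)
    · simp [St.set, St.emitGates, St.emit, List.replicate_succ', Gate.encode, encodeArgs]
    · cases i <;> simp [St.set, St.emitGates, St.emit]; omega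

/-- Write two constant gates. -/
def writeConst (b : Bool) : P :=
  block [.push .gates (if b = true then CircuitSym.conj else CircuitSym.disj),
    .push .gates (if b = true then CircuitSym.conj else CircuitSym.disj), inc .w, inc .w]

theorem exec_writeConst (b : Bool) (s : St) :
    Exec (writeConst b) s ((s.emitGates (constCell b)).set .w (s.c .w + 2)) 5 := by
  refine (exec_cons (exec_push_gates _ _) <| exec_cons (exec_push_gates _ _) <|
    exec_cons (exec_inc _ _) <| exec_cons (exec_inc _ _) <| exec_nil _).mono ?_ le_rfl
  refine St.ext rfl rfl ?_ rfl rfl rfl rfl (funext fun i => ?_)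
  · cases b <;> simp [St.set, St.emitGates, St.emit, constCell, Gate.encode, encodeArgs]
  · cases i <;> simp [St.set, St.emitGates, St.emit]

/-- Write the initial thresholds. -/
def writeInit : P :=
  block [each .u (writeConst false), each .r (writeConst true), writeConst true]

/-- The columns `d < u` are false and the next `r` are true; one more true cell completes the `n +
2` columns. -/
theorem exec_writeInit {n : ℕ} (s : St) (h : s.c .u + s.c .r = n + 1) :
    Exec writeInit s ((((s.emitGates (initGates n (s.c .u))).set .w (s.c .w + 2 * (n + 2))).set .u
      0).set .r 0) (6 * n + 20) := by
  set g : ℕ → List Gate := fun l => (List.range l).flatMap fun d => constCell (decide (s.c .u ≤ d))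
    with hg
  have hsucc : ∀ l, g (l + 1) = g l ++ constCell (decide (s.c .u ≤ l)) := by
    intro l; simp [hg, List.range_succ]
  refine (exec_cons
    (exec_each' (fun l => ((s.emitGates (g l)).set .w (s.c .w + 2 * l)).set .u (s.c .u - l))
      5 (s.c .u) ?_ rfl le_rfl ?_ ?_) <| exec_cons
    (exec_each' (fun l => (((s.emitGates (g (s.c .u + l))).set .w
      (s.c .w + 2 * (s.c .u + l))).set .u 0).set .r (s.c .r - l)) 5 (s.c .r) ?_ rfl le_rfl ?_ ?_) <|
    exec_cons (exec_writeConst _ _) <| exec_nil _).mono ?_ (by omega)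
  · ext1 <;> simp [St.set, St.emitGates, St.emit, hg]
  · intro l _; simp [St.set]
  · intro l hl
    refine (exec_writeConst _ _).mono ?_ le_rfl
    refine St.ext rfl rfl ?_ rfl rfl rfl rfl (funext fun i => ?_)
    · have : decide (s.c .u ≤ l) = false := by simpa using hl
      simp [St.set, St.emitGates, St.emit, hsucc, this]
    · cases i <;> simp [St.set, St.emitGates, St.emit]; omega
  · refine St.ext rfl rfl rfl rfl rfl rfl rfl (funext fun i => ?_)
    cases i <;> simp [St.set, St.emitGates, St.emit]
  · intro l _; simp [St.set]
  · intro l hl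
    refine (exec_writeConst _ _).mono ?_ le_rfl
    refine St.ext rfl rfl ?_ rfl rfl rfl rfl (funext fun i => ?_)
    · simp [St.set, St.emitGates, St.emit, hsucc, ← Nat.add_assoc]
    · cases i <;> simp [St.set, St.emitGates, St.emit]; omega
  · refine St.ext rfl rfl ?_ rfl rfl rfl rfl (funext fun i => ?_)
    · have : initGates n (s.c .u) = g (s.c .u + s.c .r + 1) := by rw [h]; rfl
      simp [St.set, St.emitGates, St.emit, this, hsucc]
    · cases i <;> simp [St.set, St.emitGates, St.emit]; omega

/-- Write the first gate for one threshold and one element. -/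
def writeConj : P :=
  block [.push .gates CircuitSym.conj, emitNum .y, emitNum .a, .push .gates CircuitSym.one,
    .push .gates CircuitSym.one, .push .gates CircuitSym.one]

theorem exec_writeConj (s : St) (ht : s.c .t = 0) :
    Exec writeConj s (s.emitGates [.conj [s.c .y, s.c .a + 3]])
      (5 * s.c .y + 5 * s.c .a + 11) := by
  refine (exec_cons (exec_push_gates _ _) <| exec_cons (exec_emitNum (by decide) ht) <|
    exec_cons (exec_emitNum (by decide) ht) <| exec_cons (exec_push_gates _ _) <|
    exec_cons (exec_push_gates _ _) <| exec_cons (exec_push_gates _ _) <| exec_nil _).mono ?_ ?_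
  · ext1 <;> simp [St.emitGates, St.emit, Gate.encode, encodeArgs, List.replicate_succ']
  · simp [St.emit]; omega

/-- Write the second gate for one threshold and one element. -/
def writeDisj : P :=
  block [.push .gates CircuitSym.disj, emitNum .a, .push .gates CircuitSym.one, emitNum .w]

theorem exec_writeDisj (s : St) (ht : s.c .t = 0) :
    Exec writeDisj s (s.emitGates [.disj [s.c .a + 1, s.c .w]])
      (5 * s.c .a + 5 * s.c .w + 9) := by
  refine (exec_cons (exec_push_gates _ _) <| exec_cons (exec_emitNum (by decide) ht) <|
    exec_cons (exec_push_gates _ _) <| exec_cons (exec_emitNum (by decide) ht) <|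
    exec_nil _).mono ?_ ?_
  · ext1 <;> simp [St.emitGates, St.emit, Gate.encode, encodeArgs, List.replicate_succ']
  · simp [St.emit]; omega

/-- Add two to a counter. -/
def incTwo (i : Ctr) : P :=
  .seq (inc i) (inc i)

theorem exec_incTwo (i : Ctr) (s : St) : Exec (incTwo i) s (s.set i (s.c i + 2)) 2 :=
  (exec_seq (exec_inc _ _) (exec_inc _ _)).mono (by simp [St.set]) le_rfl

/-- Write the two gates for one threshold and one element. -/
def writeCell : P :=
  block [writeConj, writeDisj, incTwo .a, incTwo .w]

/-- The counter `w` is raised only after both gates are written, so the disjunction reads the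
conjunction just before it. -/
theorem exec_writeCell {B : ℕ} (s : St) (ht : s.c .t = 0) (hy : s.c .y ≤ B) (ha : s.c .a ≤ B)
    (hw : s.c .w ≤ B) :
    Exec writeCell s (((s.emitGates (countCell (s.c .y) (s.c .a) (s.c .w))).set .a
      (s.c .a + 2)).set .w (s.c .w + 2)) (20 * B + 25) := by
  refine (exec_cons (exec_writeConj _ ht) <| exec_cons (exec_writeDisj _ ht) <|
    exec_cons (exec_incTwo _ _) <| exec_cons (exec_incTwo _ _) <| exec_nil _).mono ?_ ?_
  · ext1 <;> try rfl
    simp [St.set, St.emitGates, St.emit, countCell]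
  · simp [St.emitGates, St.emit]; omega

/-- Write the gates for one element. -/
def writeRow : P :=
  .seq (keep .v .s writeCell) (inc .y)

/-- The gates for one element. -/
def countRow (y a v l : ℕ) : List Gate :=
  (List.range l).flatMap fun d => countCell y (a + 2 * d) (a + 2 * d + 2 * v)

/-- By `hw` the new row starts `2 * v` wires after the old one, which turns `w` into the last
argument of `countCell`. The loop restores its counter through `s`, since `t` is in use by
`emitNum`. -/
theorem exec_writeRow {B v : ℕ} (s : St) (hv : s.c .v = v) (hs : s.c .s = 0) (ht : s.c .t = 0)
    (hw : s.c .w = s.c .a + 2 * v) (hy : s.c .y ≤ B) (hB : s.c .w + 2 * v ≤ B) :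
    Exec writeRow s ((((s.emitGates (countRow (s.c .y) (s.c .a) v v)).set .a
      (s.c .a + 2 * v)).set .w (s.c .w + 2 * v)).set .y (s.c .y + 1))
      (v * (20 * B + 29) + 3) := by
  have hsucc : ∀ l, countRow (s.c .y) (s.c .a) v (l + 1) = countRow (s.c .y) (s.c .a) v l ++
      countCell (s.c .y) (s.c .a + 2 * l) (s.c .a + 2 * l + 2 * v) := by
    intro l; simp [countRow, List.range_succ]
  have h : Exec (keep .v .s writeCell) s (((s.emitGates (countRow (s.c .y) (s.c .a) v v)).set .a
      (s.c .a + 2 * v)).set .w (s.c .w + 2 * v)) (v * (20 * B + 29) + 2) := by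
    refine exec_keep' (by decide) (fun l => ((s.emitGates (countRow (s.c .y) (s.c .a) v l)).set .a
      (s.c .a + 2 * l)).set .w (s.c .w + 2 * l)) (20 * B + 25) v ?_ rfl le_rfl ?_ ?_ ?_
    · ext1 <;> simp [St.set, St.emitGates, St.emit, countRow]
    · intro l _; simpa [St.set, St.emitGates, St.emit] using hv
    · intro l _; simpa [St.set, St.emitGates, St.emit] using hs
    · intro l hl
      refine (exec_writeCell (B := B) _ ?_ ?_ ?_ ?_).mono ?_ le_rfl
      · simpa [St.set, St.emitGates, St.emit] using ht
      · simpa [St.set, St.emitGates, St.emit] using hy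
      · simp [St.set]; omega
      · simp [St.set]; omega
      · refine St.ext rfl rfl ?_ rfl rfl rfl rfl (funext fun i => ?_)
        · simp [St.set, St.emitGates, St.emit, hsucc, hw, Nat.add_right_comm]
        · cases i <;> simp [St.set, St.emitGates, St.emit] <;> omega
  refine (exec_seq h (exec_inc _ _)).mono ?_ le_rfl
  simp [St.set, St.emitGates, St.emit]

/-- The gates for the first `l` elements. -/
def countRows (n y a l : ℕ) : List Gate :=
  (List.range l).flatMap fun j => countRow (y + j) (a + 2 * (n + 2) * j) (n + 2) (n + 2)

theorem countRows_succ (n y a l : ℕ) : countRows n y a (l + 1) =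
    countRows n y a l ++ countRow (y + l) (a + 2 * (n + 2) * l) (n + 2) (n + 2) := by
  simp [countRows, List.range_succ]

theorem countGates_eq_countRows (n y a : ℕ) : countGates n y a = countRows n y a n := by
  unfold countGates countRows countRow
  have h : ∀ j d, a + 2 * ((n + 2) * j + d) = a + 2 * (n + 2) * j + 2 * d := fun j d => by ring
  simp only [h]

/-- Write the gates that count the covered elements. -/
def writeCount : P :=
  each .n writeRow

theorem exec_writeCount {B n : ℕ} (s : St) (hn : s.c .n = n) (hv : s.c .v = n + 2)
    (hs : s.c .s = 0) (ht : s.c .t = 0) (hw : s.c .w = s.c .a + 2 * (n + 2))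
    (hy : s.c .y + n ≤ B) (hB : s.c .w + 2 * (n + 2) * n ≤ B) :
    Exec writeCount s (((((s.emitGates (countGates n (s.c .y) (s.c .a))).set .n 0).set .y
      (s.c .y + n)).set .a (s.c .a + 2 * (n + 2) * n)).set .w (s.c .w + 2 * (n + 2) * n))
      (n * ((n + 2) * (20 * B + 29) + 3 + 1) + 1) := by
  refine exec_each' (fun j => ((((s.emitGates (countRows n (s.c .y) (s.c .a) j)).set .n
      (n - j)).set .y (s.c .y + j)).set .a (s.c .a + 2 * (n + 2) * j)).set .w
      (s.c .w + 2 * (n + 2) * j)) ((n + 2) * (20 * B + 29) + 3) n ?_ ?_ le_rfl ?_ ?_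
  · simp [St.set, St.emitGates, St.emit, countRows, ← hn]
  · rw [countGates_eq_countRows, Nat.sub_self]
  · intro j _; simp [St.set]
  · intro j hj
    -- Row `j` is still to be written, so `j + 1 ≤ n` rows must stay within the bound `B`.
    have hjn : 2 * (n + 2) * (j + 1) ≤ 2 * (n + 2) * n := Nat.mul_le_mul_left _ hj
    rw [Nat.mul_succ] at hjn
    generalize hD : 2 * (n + 2) = D at *
    refine (exec_writeRow (B := B) (v := n + 2) _ ?_ ?_ ?_ ?_ ?_ ?_).mono ?_ le_rfl
    · simpa [St.set, St.emitGates, St.emit] using hv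
    · simpa [St.set, St.emitGates, St.emit] using hs
    · simpa [St.set, St.emitGates, St.emit] using ht
    · simp [St.set, hw, hD, Nat.add_right_comm]
    · simp [St.set]; omega
    · simp [St.set, hD]; omega
    · refine St.ext rfl rfl ?_ rfl rfl rfl rfl (funext fun i => ?_)
      · simp [St.set, St.emitGates, St.emit, countRows_succ, hD]
      · cases i <;> simp [St.set, St.emitGates, St.emit, Nat.mul_succ, hD] <;> omega

/-- Write a symbol as many times as a counter says. -/
def writeOut (i : Ctr) (b : CircuitSym) : P :=
  each i (.push .out (Sum.inl b : CircuitSym ⊕ Bool))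

theorem exec_writeOut (i : Ctr) (b : CircuitSym) (s : St) :
    Exec (writeOut i b) s ({ s with out := List.replicate (s.c i) (Sum.inl b) ++ s.out }.set i 0)
      (2 * s.c i + 1) := by
  refine exec_each' (fun l => { s with out := List.replicate l (Sum.inl b) ++ s.out }.set i
    (s.c i - l))
    1 (s.c i) (by simp [St.set]) (by simp) (by omega) ?_ ?_
  · intro l _; simp [St.set]
  · intro l hl
    refine (exec_push_out _ _).mono ?_ le_rfl
    simp [St.set, List.replicate_succ]

theorem exec_clear (i : Ctr) (s : St) : Exec (each i .skip) s (s.set i 0) (2 * s.c i + 1) := by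
  refine exec_each' (fun l => s.set i (s.c i - l)) 1 (s.c i) (by simp [St.set]) (by simp) (by omega)
    ?_ ?_
  · intro l _; simp [St.set]
  · intro l hl
    exact (exec_skip _).mono (by simp [St.set]) le_rfl

theorem exec_drainGates (l : List CircuitSym) (s : St) (hs : s.gates = l) :
    Exec (.loop .gates fun b => .push .out (Sum.inl b : CircuitSym ⊕ Bool)) s
      { s with gates := [], out := (l.map Sum.inl).reverse ++ s.out } (2 * l.length + 1) := by
  induction l generalizing s with
  | nil => exact (exec_loop_nil (k := .gates) hs).mono (by ext1 <;> simp [hs]) (by simp)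
  | cons a l ih =>
    refine (exec_loop_cons (k := .gates) hs (s.update_gates l) (exec_push_out _ _) (ih _ rfl)).mono ?_
      (by simp; omega)
    simp

end ParamComplexity

namespace ParamComplexity

open Function

/-! ### The words that describe the sets -/

theorem coverWord_append (l₁ l₂ : List FamilySym) (y x : ℕ) : coverWord (l₁ ++ l₂) y x =
    coverWord l₁ y x ++ coverWord l₂ (y + numMems l₁) (x + numSets l₁) := by
  induction l₁ generalizing y x with
  | nil => rfl
  | cons a l ih =>
    rcases a with _ | _ | b | _ | b <;>
      simp [coverWord, numMems, numSets, ih, Nat.add_assoc, Nat.add_comm 1]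

theorem numMems_append (l₁ l₂ : List FamilySym) :
    numMems (l₁ ++ l₂) = numMems l₁ + numMems l₂ := by
  induction l₁ with
  | nil => simp [numMems]
  | cons a l ih => rcases a with _ | _ | b | _ | b <;> simp [numMems, ih, Nat.add_right_comm]

theorem numSets_append (l₁ l₂ : List FamilySym) :
    numSets (l₁ ++ l₂) = numSets l₁ + numSets l₂ := by
  induction l₁ with
  | nil => simp [numSets]
  | cons a l ih => rcases a with _ | _ | b | _ | b <;> simp [numSets, ih, Nat.add_right_comm]

/-- The description of the sets with a given membership matrix. -/
def rowsWord (mem : ℕ → ℕ → Bool) (n m : ℕ) : List FamilySym :=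
  (List.range m).flatMap fun i => .set :: (List.range n).map fun j => .mem (mem i j)

theorem coverWord_map (g : ℕ → Bool) (n y x : ℕ) :
    coverWord ((List.range n).map fun j => .mem (g j)) y x =
      (List.range n).map fun j => coverGate (y + j) x (g j) := by
  -- The induction removes entries at the front, after which positions and entries of a range no
  -- longer agree; hence an arbitrary list with separate positions.
  have h : ∀ (l : List ℕ) (y : ℕ), coverWord (l.map fun j => .mem (g j)) y x =
      l.mapIdx fun i j => coverGate (y + i) x (g j) := by
    intro l
    induction l with
    | nil => intro y; rfl
    | cons a l ih => intro y; simp [coverWord, ih, Nat.add_assoc, Nat.add_comm 1]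
  rw [h]
  refine List.ext_getElem (by simp) fun i h₁ h₂ => ?_
  simp

theorem numMems_map (g : ℕ → Bool) (l : List ℕ) :
    numMems (l.map fun j => .mem (g j)) = l.length := by
  induction l with
  | nil => rfl
  | cons a l ih => simp [numMems, ih]

theorem numSets_map (g : ℕ → Bool) (l : List ℕ) : numSets (l.map fun j => .mem (g j)) = 0 := by
  induction l with
  | nil => rfl
  | cons a l ih => simp [numSets, ih]

theorem numMems_rowsWord (mem : ℕ → ℕ → Bool) (n m : ℕ) : numMems (rowsWord mem n m) = n * m := by
  induction m with
  | zero => rfl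
  | succ m ih =>
    rw [rowsWord, List.range_succ, List.flatMap_append, numMems_append, ← rowsWord, ih]
    simp [numMems, numMems_map, Nat.mul_succ]

theorem numSets_rowsWord (mem : ℕ → ℕ → Bool) (n m : ℕ) : numSets (rowsWord mem n m) = m := by
  induction m with
  | zero => rfl
  | succ m ih =>
    rw [rowsWord, List.range_succ, List.flatMap_append, numSets_append, ← rowsWord, ih]
    simp [numSets, numSets_map]

theorem length_rowsWord (mem : ℕ → ℕ → Bool) (n m : ℕ) :
    (rowsWord mem n m).length = n * m + m := by
  simp [rowsWord, List.length_flatMap]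
  ring

/-- Each block opens with its mark, which raises `x` before the bits of that set are met; hence the
shift to `x + 1`. -/
theorem coverWord_rowsWord (mem : ℕ → ℕ → Bool) (n m y x : ℕ) :
    coverWord (rowsWord mem n m) y x = coverGates mem n m y (x + 1) := by
  induction m with
  | zero => rfl
  | succ m ih =>
    have h := numMems_rowsWord mem n m
    have h' := numSets_rowsWord mem n m
    rw [rowsWord, coverGates, List.range_succ, List.flatMap_append, List.flatMap_append,
      coverWord_append, ← rowsWord, ← coverGates, ih, h, h']
    simp [coverWord, coverWord_map, Nat.add_assoc, Nat.add_comm 1]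

theorem SetFamily.flatMap_encodeSet (I : SetFamily) :
    (List.ofFn I.S).flatMap encodeSet = rowsWord I.mem I.n I.m := by
  have h : ∀ f : ℕ → List FamilySym, (List.range I.m).flatMap f =
      (List.finRange I.m).flatMap fun i : Fin I.m => f i := by
    intro f
    rw [← List.map_coe_finRange_eq_range, List.flatMap_map]
  rw [rowsWord, h, List.ofFn_eq_map, List.flatMap_map]
  congr 1
  funext i
  rw [encodeSet, ← List.map_coe_finRange_eq_range, List.ofFn_eq_map, List.map_map]
  congr 2
  funext j
  simp [SetFamily.mem]

/-- The values of the counters. -/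
def cnt (n m k u r w x y a v : ℕ) : Ctr → ℕ
  | .n => n
  | .m => m
  | .k => k
  | .u => u
  | .r => r
  | .w => w
  | .x => x
  | .y => y
  | .a => a
  | .v => v
  | .s => 0
  | .t => 0

section cnt

variable (n m k u r w x y a v i : ℕ)

@[simp] theorem update_cnt_n : update (cnt n m k u r w x y a v) .n i = cnt i m k u r w x y a v := by
  funext j; cases j <;> rfl

@[simp] theorem update_cnt_m : update (cnt n m k u r w x y a v) .m i = cnt n i k u r w x y a v := by
  funext j; cases j <;> rfl

@[simp] theorem update_cnt_k : update (cnt n m k u r w x y a v) .k i = cnt n m i u r w x y a v := by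
  funext j; cases j <;> rfl

@[simp] theorem update_cnt_u : update (cnt n m k u r w x y a v) .u i = cnt n m k i r w x y a v := by
  funext j; cases j <;> rfl

@[simp] theorem update_cnt_r : update (cnt n m k u r w x y a v) .r i = cnt n m k u i w x y a v := by
  funext j; cases j <;> rfl

@[simp] theorem update_cnt_w : update (cnt n m k u r w x y a v) .w i = cnt n m k u r i x y a v := by
  funext j; cases j <;> rfl

@[simp] theorem update_cnt_x : update (cnt n m k u r w x y a v) .x i = cnt n m k u r w i y a v := by
  funext j; cases j <;> rfl

@[simp] theorem update_cnt_y : update (cnt n m k u r w x y a v) .y i = cnt n m k u r w x i a v := by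
  funext j; cases j <;> rfl

@[simp] theorem update_cnt_a : update (cnt n m k u r w x y a v) .a i = cnt n m k u r w x y i v := by
  funext j; cases j <;> rfl

@[simp] theorem update_cnt_v : update (cnt n m k u r w x y a v) .v i = cnt n m k u r w x y a i := by
  funext j; cases j <;> rfl

end cnt

/-! ### The effect of reading -/

theorem foldl_parseStep_elem (n : ℕ) (s : St) :
    (List.replicate n (.inl .elem)).foldl parseStep s = s.set .n (s.c .n + n) := by
  induction n generalizing s with
  | zero => simp [St.set]
  | succ n ih =>
    rw [List.replicate_succ, List.foldl_cons, ih]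
    simp [parseStep, St.set, Nat.add_assoc, Nat.add_comm 1]

theorem foldl_parseStep_bit (l : List Bool) (s : St) :
    (l.map fun b => .inl (.bit b)).foldl parseStep s =
      { s with pbits := l.reverse ++ s.pbits } := by
  induction l generalizing s with
  | nil => rfl
  | cons b l ih => rw [List.map_cons, List.foldl_cons, ih]; simp [parseStep]

theorem foldl_parseStep_param (l : List Bool) (s : St) :
    (l.map .inr).foldl parseStep s = { s with kbits := l.reverse ++ s.kbits } := by
  induction l generalizing s with
  | nil => rfl
  | cons b l ih => rw [List.map_cons, List.foldl_cons, ih]; simp [parseStep]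

theorem foldl_parseStep_rows (l : List FamilySym) (h : ∀ a ∈ l, a = .set ∨ ∃ b, a = .mem b)
    (s : St) : (l.map .inl).foldl parseStep s =
      { s with mat := l.reverse ++ s.mat }.set .m (s.c .m + numSets l) := by
  induction l generalizing s with
  | nil => simp [numSets, St.set]
  | cons a l ih =>
    rw [List.map_cons, List.foldl_cons, ih fun a ha => h a (List.mem_cons_of_mem _ ha)]
    obtain rfl | ⟨b, rfl⟩ := h a (by simp)
    · simp [parseStep, St.set, numSets, Nat.add_assoc, Nat.add_comm 1]
    · simp [parseStep, St.set, numSets]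

theorem mem_rowsWord {mem : ℕ → ℕ → Bool} {n m : ℕ} (a : FamilySym) (h : a ∈ rowsWord mem n m) :
    a = .set ∨ ∃ b, a = .mem b := by
  simp only [rowsWord, List.mem_flatMap, List.mem_cons, List.mem_map] at h
  obtain ⟨i, -, rfl | ⟨j, -, rfl⟩⟩ := h
  · exact Or.inl rfl
  · exact Or.inr ⟨_, rfl⟩

/-- The stacks at the beginning. -/
def St.initial (l : List (FamilySym ⊕ Bool)) : St :=
  ⟨l, [], [], [], [], [], [], cnt 0 0 0 0 0 0 0 0 0 0⟩

theorem SetFamily.encode_eq (I : SetFamily) : I.encode = List.replicate I.n .elem ++ .target ::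
    ((Computability.encodeNat I.p).map .bit ++ rowsWord I.mem I.n I.m) := by
  rw [SetFamily.encode, I.flatMap_encodeSet]

/-- Moving a word between stacks reverses it. For the two binary numbers this puts the most
significant bit on top, as Horner's rule needs; the rows have to be turned round again. -/
theorem foldl_parseStep_input (I : SetFamily) (k : ℕ) (l : List (FamilySym ⊕ Bool)) :
    (maxKSetCover.input (I, k)).foldl parseStep { St.initial l with inp := [] } =
      ⟨[], [], [], (rowsWord I.mem I.n I.m).reverse, [], (Computability.encodeNat I.p).reverse,
        (Computability.encodeNat k).reverse, cnt I.n I.m 0 0 0 0 0 0 0 0⟩ := by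
  change ((I.encode.map Sum.inl) ++ (Computability.encodeNat k).map Sum.inr).foldl parseStep _ = _
  rw [I.encode_eq, List.foldl_append, foldl_parseStep_param, List.map_append, List.map_cons,
    List.map_append, List.map_replicate, List.map_map, List.foldl_append, foldl_parseStep_elem,
    List.foldl_cons, List.foldl_append]
  have := foldl_parseStep_bit (Computability.encodeNat I.p)
  simp only [Function.comp_def]
  rw [this, foldl_parseStep_rows _ mem_rowsWord]
  simp [parseStep, St.initial, St.set, numSets_rowsWord, cnt]

/-- `Computability.encodePosNum` lists the least significant bit at the front, so Horner's rule is a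
right fold. -/
theorem foldr_horner_encodePosNum (p : PosNum) :
    (Computability.encodePosNum p).foldr (fun b u => horner u b) 0 = p := by
  induction p with
  | one => rfl
  | bit0 p ih =>
    rw [Computability.encodePosNum, List.foldr_cons, ih, horner, PosNum.cast_bit0]
    simp [two_mul]
  | bit1 p ih =>
    rw [Computability.encodePosNum, List.foldr_cons, ih, horner, PosNum.cast_bit1]
    simp [two_mul]

theorem foldl_horner_encodeNat (k : ℕ) :
    (Computability.encodeNat k).reverse.foldl horner 0 = k := by
  rw [List.foldl_reverse, Computability.encodeNat]
  conv_rhs => rw [← Num.to_of_nat k]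
  cases (k : Num) with
  | zero => rfl
  | pos p => exact foldr_horner_encodePosNum p

theorem length_input (I : SetFamily) (k : ℕ) : (maxKSetCover.input (I, k)).length =
    I.n + 1 + (Computability.encodeNat I.p).length + (I.n * I.m + I.m) +
      (Computability.encodeNat k).length := by
  change ((I.encode.map Sum.inl) ++ (Computability.encodeNat k).map Sum.inr).length = _
  rw [I.encode_eq]
  simp [length_rowsWord]
  ring

end ParamComplexity

namespace ParamComplexity

open Function

/-! ### The reduction -/

/-- Run several programs one after another. -/
def chain (p : P) (l : List P) : P :=
  l.foldl .seq p

/-- The reached state can be restated in normal form at each composition, so that updates do not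
pile up. -/
theorem Exec.next {p q : P} {s s₁ s' s₂ : St} {t t' : ℕ} (h : Exec p s s₁ t) (h' : Exec q s₁ s' t')
    (hs : s' = s₂) : Exec (.seq p q) s s₂ (t + t') :=
  exec_seq h (hs ▸ h')

/-- Read the input. -/
def readInput : P :=
  chain (.loop .inp parseSym) [readParam, addTo .n .r, inc .r, readTarget, reverseRows]

/-- Initialize the counters. -/
def initCounters : P :=
  chain (addTo .k .x) [addTo .k .w, inc .w, addTo .m .w, addTo .w .y, addTo .n .v, incTwo .v]

/-- Write all gates. -/
def writeGates : P :=
  chain writeBase [.loop .rows coverSym, addTo .w .a, writeInit, writeCount]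

/-- Write the output. -/
def writeOutput : P :=
  chain (.loop .gates fun b => .push .out (Sum.inl b : CircuitSym ⊕ Bool)) [
    .push .out (Sum.inl CircuitSym.one : CircuitSym ⊕ Bool), writeOut .a .one,
    .push .out (Sum.inl CircuitSym.out : CircuitSym ⊕ Bool), writeOut .m .input, writeOut .k .input,
    .push .out (Sum.inl CircuitSym.input : CircuitSym ⊕ Bool),
    each .w .skip, each .x .skip, each .y .skip, each .v .skip]

/-- The program that computes the reduction. -/
def reduction : P :=
  chain readInput [initCounters, writeGates, writeOutput]

theorem exec_readInput {B : ℕ} (I : SetFamily) (k : ℕ) (hk : k ≤ B)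
    (hB : (maxKSetCover.input (I, k)).length ≤ B) :
    Exec readInput (St.initial (maxKSetCover.input (I, k)))
      ⟨[], (Computability.encodeNat k).map .inr, [], [], rowsWord I.mem I.n I.m, [], [],
        cnt I.n I.m k (min I.p (I.n + 1)) (I.n + 1 - min I.p (I.n + 1)) 0 0 0 0 0⟩
      (19 * (B * B) + 28 * B + 10) := by
  have hlen := length_input I k
  have e₁ := (exec_parse _ (St.initial (maxKSetCover.input (I, k))) rfl).mono
    (foldl_parseStep_input I k _) le_rfl
  have e₂ := e₁.next (s₂ := ⟨[], (Computability.encodeNat k).map .inr, [],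
      (rowsWord I.mem I.n I.m).reverse, [], (Computability.encodeNat I.p).reverse, [],
      cnt I.n I.m k 0 0 0 0 0 0 0⟩)
      (exec_readParam (B := B) (Computability.encodeNat k).reverse _ rfl rfl
      ((foldl_horner_encodeNat k).trans_le hk))
      (by simp [St.set, cnt, -List.foldl_reverse, foldl_horner_encodeNat])
  have e₃ := e₂.next (s₂ := ⟨[], (Computability.encodeNat k).map .inr, [],
      (rowsWord I.mem I.n I.m).reverse, [], (Computability.encodeNat I.p).reverse, [],
      cnt I.n I.m k 0 I.n 0 0 0 0 0⟩)
      (exec_addTo (i := .n) (j := .r) (by decide) (by decide) (by decide) rfl)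
      (by simp [St.set, cnt])
  have e₄ := e₃.next (s₂ := ⟨[], (Computability.encodeNat k).map .inr, [],
      (rowsWord I.mem I.n I.m).reverse, [], (Computability.encodeNat I.p).reverse, [],
      cnt I.n I.m k 0 (I.n + 1) 0 0 0 0 0⟩) (exec_inc .r _)
      (by simp [St.set, cnt])
  have e₅ := e₄.next (s₂ := ⟨[], (Computability.encodeNat k).map .inr, [],
      (rowsWord I.mem I.n I.m).reverse, [], [], [],
      cnt I.n I.m k (min I.p (I.n + 1)) (I.n + 1 - min I.p (I.n + 1)) 0 0 0 0 0⟩)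
      (exec_readTarget (R := I.n + 1) (h₀ := 0) (Computability.encodeNat I.p).reverse _ rfl rfl
      (by simp [cnt]) (by simp [cnt]))
      (by simp [St.set, -List.foldl_reverse, foldl_horner_encodeNat])
  have e₆ := e₅.next (s₂ := ⟨[], (Computability.encodeNat k).map .inr, [],
      [], rowsWord I.mem I.n I.m, [], [],
      cnt I.n I.m k (min I.p (I.n + 1)) (I.n + 1 - min I.p (I.n + 1)) 0 0 0 0 0⟩)
      (exec_reverseRows _ _ rfl)
      (by simp)
  refine e₆.mono rfl ?_
  simp only [List.length_reverse, length_rowsWord, cnt]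
  have h₁ : (Computability.encodeNat k).length * (8 * B + 6) ≤ B * (8 * B + 6) :=
    Nat.mul_le_mul_right _ (by omega)
  have h₂ : (Computability.encodeNat I.p).length * (11 * (I.n + 1) + 6) ≤ B * (11 * B + 6) :=
    Nat.mul_le_mul (by omega) (by omega)
  have h₃ : B * (8 * B + 6) = 8 * (B * B) + 6 * B := by ring
  have h₄ : B * (11 * B + 6) = 11 * (B * B) + 6 * B := by ring
  have h₅ : (St.initial (maxKSetCover.input (I, k))).inp.length =
    (maxKSetCover.input (I, k)).length := rfl
  omega

theorem exec_initCounters {B : ℕ} (rows : List FamilySym) (out : List (CircuitSym ⊕ Bool))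
    (n m k u r : ℕ) (hB : k + 1 + m + n ≤ B) :
    Exec initCounters ⟨[], out, [], [], rows, [], [], cnt n m k u r 0 0 0 0 0⟩
      ⟨[], out, [], [], rows, [], [], cnt n m k u r (k + 1 + m) k (k + 1 + m) 0 (n + 2)⟩
      (25 * B + 14) := by
  have e₁ : Exec (addTo .k .x) _
      ⟨[], out, [], [], rows, [], [], cnt n m k u r 0 k 0 0 0⟩ _ :=
    (exec_addTo (s := ⟨[], out, [], [], rows, [], [], cnt n m k u r 0 0 0 0 0⟩) (by decide)
      (by decide) (by decide) rfl).mono (by simp [St.set, cnt]) le_rfl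
  have e₂ := e₁.next (s₂ := ⟨[], out, [], [], rows, [], [], cnt n m k u r k k 0 0 0⟩)
      (exec_addTo (i := .k) (j := .w) (by decide) (by decide) (by decide) rfl)
      (by simp [St.set, cnt])
  have e₃ := e₂.next (s₂ := ⟨[], out, [], [], rows, [], [], cnt n m k u r (k + 1) k 0 0 0⟩)
      (exec_inc .w _)
      (by simp [St.set, cnt])
  have e₄ := e₃.next (s₂ := ⟨[], out, [], [], rows, [], [], cnt n m k u r (k + 1 + m) k 0 0 0⟩)
      (exec_addTo (i := .m) (j := .w) (by decide) (by decide) (by decide) rfl)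
      (by simp [St.set, cnt])
  have e₅ := e₄.next (s₂ := ⟨[], out, [], [], rows, [], [], cnt n m k u r (k + 1 + m) k (k + 1 + m) 0 0⟩)
      (exec_addTo (i := .w) (j := .y) (by decide) (by decide) (by decide) rfl)
      (by simp [St.set, cnt])
  have e₆ := e₅.next (s₂ := ⟨[], out, [], [], rows, [], [], cnt n m k u r (k + 1 + m) k (k + 1 + m) 0 n⟩)
      (exec_addTo (i := .n) (j := .v) (by decide) (by decide) (by decide) rfl)
      (by simp [St.set, cnt])
  have e₇ := e₆.next (s₂ := ⟨[], out, [], [], rows, [], [], cnt n m k u r (k + 1 + m) k (k + 1 + m) 0 (n + 2)⟩)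
      (exec_incTwo .v _)
      (by simp [St.set, cnt])
  refine e₇.mono rfl ?_
  simp only [cnt]
  omega

/-- The list of gates, as it is on its stack. -/
def gatesWord (l : List Gate) : List CircuitSym :=
  (l.flatMap Gate.encode).reverse

theorem exec_writeGates {B : ℕ} (out : List (CircuitSym ⊕ Bool)) (mem : ℕ → ℕ → Bool)
    (n m k u r : ℕ) (hu : u + r = n + 1)
    (hB : k + 1 + m + (n + (n * m + (2 * (n + 2) + 2 * (n + 2) * n))) ≤ B)
    (hrows : n * m + m ≤ B) :
    Exec writeGates
      ⟨[], out, [], [], rowsWord mem n m, [], [],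
        cnt n m k u r (k + 1 + m) k (k + 1 + m) 0 (n + 2)⟩
      ⟨[], out, gatesWord (thresholdCoverGates mem n m k u), [], [], [], [],
        cnt 0 m k 0 0 (k + 1 + m + n * m + n + 2 * (n + 2) + 2 * (n + 2) * n) (k + m)
          (k + 1 + m + n * m + n) (k + 1 + m + n * m + n + 2 * (n + 2) * n) (n + 2)⟩
      (20 * (B * (B * B)) + 39 * (B * B) + 33 * B + 30) := by
  have e₁ : Exec writeBase _ ⟨[], out, gatesWord (List.replicate n (.disj [])), [],
      rowsWord mem n m, [], [], cnt n m k u r (k + 1 + m + n) k (k + 1 + m) 0 (n + 2)⟩ _ :=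
    (exec_writeBase ⟨[], out, [], [], rowsWord mem n m, [], [],
      cnt n m k u r (k + 1 + m) k (k + 1 + m) 0 (n + 2)⟩ rfl).mono
      (by simp [St.set, St.emitGates, St.emit, cnt, gatesWord]) le_rfl
  have e₂ := e₁.next (s₂ := ⟨[], out, gatesWord (List.replicate n (.disj []) ++
      coverGates mem n m (k + 1 + m) (k + 1)), [], [], [], [],
      cnt n m k u r (k + 1 + m + n * m + n) (k + m) (k + 1 + m + n * m) 0 (n + 2)⟩)
      (exec_cover (B := B) _ _ rfl rfl (by rw [numSets_rowsWord]; simp only [cnt]; omega)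
      (by rw [numMems_rowsWord]; simp only [cnt]; omega))
      (by simp [St.set, St.emitGates, St.emit, cnt, gatesWord, numSets_rowsWord, numMems_rowsWord,
        coverWord_rowsWord, Nat.add_right_comm _ n (n * m)])
  have e₃ := e₂.next (s₂ := ⟨[], out, gatesWord (List.replicate n (.disj []) ++
      coverGates mem n m (k + 1 + m) (k + 1)), [], [], [], [],
      cnt n m k u r (k + 1 + m + n * m + n) (k + m) (k + 1 + m + n * m)
        (k + 1 + m + n * m + n) (n + 2)⟩)
      (exec_addTo (i := .w) (j := .a) (by decide) (by decide) (by decide) rfl)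
      (by simp [St.set, cnt])
  have e₄ := e₃.next (s₂ := ⟨[], out, gatesWord (List.replicate n (.disj []) ++
      (coverGates mem n m (k + 1 + m) (k + 1) ++ initGates n u)), [], [], [], [],
      cnt n m k 0 0 (k + 1 + m + n * m + n + 2 * (n + 2)) (k + m) (k + 1 + m + n * m)
        (k + 1 + m + n * m + n) (n + 2)⟩) (exec_writeInit (n := n) _ hu)
      (by simp [St.set, St.emitGates, St.emit, cnt, gatesWord])
  have e₅ := e₄.next (s₂ := ⟨[], out, gatesWord (thresholdCoverGates mem n m k u), [], [], [], [],
        cnt 0 m k 0 0 (k + 1 + m + n * m + n + 2 * (n + 2) + 2 * (n + 2) * n) (k + m)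
          (k + 1 + m + n * m + n) (k + 1 + m + n * m + n + 2 * (n + 2) * n) (n + 2)⟩)
      (exec_writeCount (B := B) (n := n) _ rfl rfl rfl rfl rfl (by simp only [cnt]; omega)
      (by simp only [cnt]; omega))
      (by simp [St.set, St.emitGates, St.emit, cnt, gatesWord, thresholdCoverGates])
  refine e₅.mono rfl ?_
  simp only [length_rowsWord, cnt]
  have h₁ : (n * m + m) * (10 * B + 11) ≤ B * (10 * B + 11) := Nat.mul_le_mul_right _ hrows
  -- The source of the cubic term: at most `B` elements times at most `B` columns, with cells
  -- written in time linear in `B`.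
  have h₂ : n * ((n + 2) * (20 * B + 29) + 3 + 1) ≤ B * (B * (20 * B + 29) + 3 + 1) := by
    have : n ≤ B := by omega
    have : n + 2 ≤ B := by omega
    gcongr
  have h₃ : B * (10 * B + 11) = 10 * (B * B) + 11 * B := by ring
  have h₄ : B * (B * (20 * B + 29) + 3 + 1) = 20 * (B * (B * B)) + 29 * (B * B) + 4 * B := by ring
  omega

/-- The word is built from its end, since a stack is read from the top; in use, `out` already holds
the bits of the parameter. The additional `one` leads from the start `a` of the last row of
thresholds to the second gate of its first cell, the output. The leftover counters are emptied
because the halting configuration allows no stack but the output. -/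
theorem exec_writeOutput {B : ℕ} (out : List (CircuitSym ⊕ Bool)) (g : List Gate)
    (m k w x y a v : ℕ) (hg : (g.flatMap Gate.encode).length ≤ 2 * (B * B) + B)
    (hB : m ≤ B ∧ k ≤ B ∧ w ≤ B ∧ x ≤ B ∧ y ≤ B ∧ a ≤ B ∧ v ≤ B) :
    Exec writeOutput ⟨[], out, gatesWord g, [], [], [], [], cnt 0 m k 0 0 w x y a v⟩
      ⟨[], (List.replicate (k + 1 + m) CircuitSym.input ++ CircuitSym.out ::
        (List.replicate (a + 1) CircuitSym.one ++
        g.flatMap Gate.encode)).map .inl ++ out, [], [], [], [], [], cnt 0 0 0 0 0 0 0 0 0 0⟩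
      (4 * (B * B) + 16 * B + 20) := by
  have e₁ : Exec (.loop .gates fun b => .push .out (Sum.inl b : CircuitSym ⊕ Bool)) _
      ⟨[], (g.flatMap Gate.encode).map .inl ++ out, [], [], [], [], [], cnt 0 m k 0 0 w x y a v⟩ _ :=
    (exec_drainGates _ ⟨[], out, gatesWord g, [], [], [], [], cnt 0 m k 0 0 w x y a v⟩ rfl).mono
      (by simp [gatesWord]) le_rfl
  obtain ⟨o, ho⟩ : ∃ o : List (CircuitSym ⊕ Bool), o = (g.flatMap Gate.encode).map .inl ++ out :=
    ⟨_, rfl⟩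
  rw [← ho] at e₁
  obtain ⟨o₁, ho₁⟩ : ∃ o₁ : List (CircuitSym ⊕ Bool),
      List.replicate a (.inl .one) ++ .inl .one :: o = o₁ := ⟨_, rfl⟩
  obtain ⟨o₂, ho₂⟩ : ∃ o₂ : List (CircuitSym ⊕ Bool),
      List.replicate m (.inl .input) ++ .inl .out :: o₁ = o₂ := ⟨_, rfl⟩
  obtain ⟨o₃, ho₃⟩ : ∃ o₃ : List (CircuitSym ⊕ Bool),
      List.replicate k (.inl .input) ++ o₂ = o₃ := ⟨_, rfl⟩
  have e₂ := e₁.next (s₂ := ⟨[], .inl .one :: o, [], [], [], [], [], cnt 0 m k 0 0 w x y a v⟩)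
    (exec_push_out (Sum.inl .one) _) rfl
  have e₃ := e₂.next (s₂ := ⟨[], o₁, [], [], [], [], [], cnt 0 m k 0 0 w x y 0 v⟩)
    (exec_writeOut .a .one _) (by simp [St.set, cnt, ho₁])
  have e₄ := e₃.next (s₂ := ⟨[], .inl .out :: o₁, [], [], [], [], [], cnt 0 m k 0 0 w x y 0 v⟩)
    (exec_push_out (Sum.inl .out) _) rfl
  have e₅ := e₄.next (s₂ := ⟨[], o₂, [], [], [], [], [], cnt 0 0 k 0 0 w x y 0 v⟩)
    (exec_writeOut .m .input _) (by simp [St.set, cnt, ho₂])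
  have e₆ := e₅.next (s₂ := ⟨[], o₃, [], [], [], [], [], cnt 0 0 0 0 0 w x y 0 v⟩)
    (exec_writeOut .k .input _) (by simp [St.set, cnt, ho₃])
  have e₇ := e₆.next (s₂ := ⟨[], .inl .input :: o₃, [], [], [], [], [], cnt 0 0 0 0 0 w x y 0 v⟩)
    (exec_push_out (Sum.inl .input) _) rfl
  have e₈ := e₇.next (s₂ := ⟨[], .inl .input :: o₃, [], [], [], [], [], cnt 0 0 0 0 0 0 x y 0 v⟩)
    (exec_clear .w _) (by simp [St.set])
  have e₉ := e₈.next (s₂ := ⟨[], .inl .input :: o₃, [], [], [], [], [], cnt 0 0 0 0 0 0 0 y 0 v⟩)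
    (exec_clear .x _) (by simp [St.set])
  have e₁₀ := e₉.next (s₂ := ⟨[], .inl .input :: o₃, [], [], [], [], [], cnt 0 0 0 0 0 0 0 0 0 v⟩)
    (exec_clear .y _) (by simp [St.set])
  have e₁₁ := e₁₀.next (s₂ := ⟨[], .inl .input :: o₃, [], [], [], [], [], cnt 0 0 0 0 0 0 0 0 0 0⟩)
    (exec_clear .v _) (by simp [St.set])
  refine e₁₁.mono ?_ ?_
  · have h : List.replicate (k + 1 + m) CircuitSym.input =
        .input :: (List.replicate k .input ++ List.replicate m .input) := by
      rw [Nat.add_right_comm, List.replicate_succ, List.replicate_add]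
    rw [h, List.replicate_succ', ← ho₃, ← ho₂, ← ho₁, ho]
    simp [-List.replicate_append_replicate]
  · simp only [cnt, gatesWord, List.length_reverse]
    omega

end ParamComplexity

namespace ParamComplexity

open Function

/-! ### Length of the description of the circuit and total running time -/

theorem length_encodeArgs_le {B : ℕ} (l : List ℕ) (h : ∀ a ∈ l, a < B) :
    (encodeArgs l).length ≤ l.length * B := by
  induction l with
  | nil => simp [encodeArgs]
  | cons a l ih =>
    have h₁ := ih fun a ha => h a (List.mem_cons_of_mem _ ha)
    have h₂ := h a (by simp)
    have h₃ : (encodeArgs (a :: l)).length = a + 1 + (encodeArgs l).length := by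
      simp [encodeArgs, List.flatMap_cons]
      omega
    rw [h₃, List.length_cons, Nat.add_one_mul]
    omega

theorem Gate.length_encode_le {B : ℕ} (g : Gate) (h : g.args.length ≤ 2) (hB : ∀ a ∈ g.args, a < B) :
    g.encode.length ≤ 2 * B + 1 := by
  have h₁ : g.encode.length = (encodeArgs g.args).length + 1 := by cases g <;> rfl
  have h₂ := length_encodeArgs_le g.args hB
  have h₃ : g.args.length * B ≤ 2 * B := Nat.mul_le_mul_right _ h
  omega

/-- With fan-in at most two, a gate costs at most two unary wire numbers, so the description is at
most quadratic in the number of wires. -/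
theorem args_thresholdCoverGates (mem : ℕ → ℕ → Bool) (n m k u : ℕ) (g : Gate)
    (hg : g ∈ thresholdCoverGates mem n m k u) : g.args.length ≤ 2 := by
  simp only [thresholdCoverGates, coverGates, initGates, countGates, List.mem_append,
    List.mem_replicate, List.mem_flatMap, List.mem_map] at hg
  obtain ⟨-, rfl⟩ | ⟨i, -, j, -, rfl⟩ | ⟨d, -, hg⟩ | ⟨j, -, d, -, hg⟩ := hg
  · simp [Gate.args]
  · unfold coverGate
    split_ifs <;> simp [Gate.args]
  · unfold constCell at hg
    split_ifs at hg <;> simp at hg <;> simp [hg, Gate.args]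
  · simp only [countCell, List.mem_cons, List.not_mem_nil, or_false] at hg
    obtain rfl | rfl := hg <;> simp [Gate.args]

theorem length_flatMap_encode_le {B b : ℕ} {l : List Gate} (ht : Topological b l)
    (ha : ∀ g ∈ l, g.args.length ≤ 2) (hB : b + l.length ≤ B) :
    (l.flatMap Gate.encode).length ≤ l.length * (2 * B + 1) := by
  induction l generalizing b with
  | nil => simp
  | cons g l ih =>
    rw [List.length_cons] at hB
    have h₁ := ih ht.2 (fun g hg => ha g (List.mem_cons_of_mem _ hg)) (by omega)
    have h₂ := g.length_encode_le (B := B) (ha g (by simp)) fun a h => by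
      have := ht.1 a h
      omega
    rw [List.flatMap_cons, List.length_append, List.length_cons, Nat.add_one_mul]
    omega

/-- One number `B` dominates the input length and the number of wires, hence also `k`. The
coefficients of the time bound are the sums of those of the four stages. -/
theorem exec_reduction {B : ℕ} (I : SetFamily) (k : ℕ)
    (hL : (maxKSetCover.input (I, k)).length ≤ B)
    (hB : k + 1 + I.m + (I.n + (I.n * I.m + (2 * (I.n + 2) + 2 * (I.n + 2) * I.n))) ≤ B) :
    Exec reduction (St.initial (maxKSetCover.input (I, k)))
      ⟨[], weightedCircuitSat.input (I.circuit k, k), [], [], [], [], [],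
        cnt 0 0 0 0 0 0 0 0 0 0⟩ (20 * (B * (B * B)) + 62 * (B * B) + 102 * B + 74) := by
  have hlen := length_input I k
  have hw : ((thresholdCoverGates I.mem I.n I.m k (min I.p (I.n + 1))).flatMap
      Gate.encode).length ≤ 2 * (B * B) + B := by
    have hl := length_thresholdCoverGates I.mem I.n I.m k (min I.p (I.n + 1))
    refine (length_flatMap_encode_le (B := B) (topological_thresholdCoverGates _ _ _ _ _)
      (args_thresholdCoverGates _ _ _ _ _) (by omega)).trans ?_
    refine (Nat.mul_le_mul_right _ (by omega : _ ≤ B)).trans (le_of_eq ?_)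
    ring
  have e₁ := exec_readInput (B := B) I k (by omega) hL
  have e₂ := e₁.next (exec_initCounters (B := B) _ _ _ _ _ _ _ (by omega)) rfl
  have e₃ := e₂.next (exec_writeGates (B := B) _ _ _ _ _ _ _ (by omega) hB (by omega)) rfl
  have e₄ := e₃.next (exec_writeOutput (B := B) _ _ _ _ _ _ _ _ _ hw (by omega)) rfl
  exact e₄.mono rfl (by omega)

/-! ### From the program to the Turing machine -/

theorem St.store_initial (l : List (FamilySym ⊕ Bool)) :
    (St.initial l).store = update (β := fun k => List (Alph k)) (fun _ => []) Stk.inp l := by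
  funext i
  rcases i with _ | _ | _ | _ | _ | _ | _ | i <;> try rfl
  cases i <;> rfl

theorem St.store_final (l : List (CircuitSym ⊕ Bool)) :
    (⟨[], l, [], [], [], [], [], cnt 0 0 0 0 0 0 0 0 0 0⟩ : St).store =
      update (β := fun k => List (Alph k)) (fun _ => []) Stk.out l := by
  funext i
  rcases i with _ | _ | _ | _ | _ | _ | _ | i <;> try rfl
  cases i <;> rfl

theorem Exec.machine_outputs {p : P} {x : List (FamilySym ⊕ Bool)} {y : List (CircuitSym ⊕ Bool)}
    {t : ℕ} (h : Exec p (St.initial x) ⟨[], y, [], [], [], [], [], cnt 0 0 0 0 0 0 0 0 0 0⟩ t) :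
    Nonempty (Turing.TM2OutputsInTime (Prog.machine Stk.inp Stk.out p) x (some y) (t + 1)) := by
  unfold Exec at h
  rw [St.store_initial, St.store_final] at h
  exact Prog.Runs.machine_outputs h

/-- The number of wires is `k` plus a term quadratic in `L`, dominated by the `2 * (n + 2) * (n +
1)` gates of the thresholds. The product form separates `k` from `L`, as the definition of fpt time
requires. -/
theorem reduction_time (L k n m : ℕ) (hL : n + 1 + (n * m + m) ≤ L) :
    L ≤ 4 * ((k + 1) * (L + 1) ^ 2) ∧
      k + 1 + m + (n + (n * m + (2 * (n + 2) + 2 * (n + 2) * n))) ≤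
        4 * ((k + 1) * (L + 1) ^ 2) := by
  have h₁ : (k + 1) * (L + 1) ^ 2 = k * (L + 1) ^ 2 + L * L + 2 * L + 1 := by ring
  have h₂ : k ≤ k * (L + 1) ^ 2 := Nat.le_mul_of_pos_right _ (by positivity)
  have h₃ : (n + 2) * (n + 1) ≤ (L + 1) * L := Nat.mul_le_mul (by omega) (by omega)
  have h₄ : (L + 1) * L = L * L + L := by ring
  have h₅ : 2 * (n + 2) + 2 * (n + 2) * n = 2 * ((n + 2) * (n + 1)) := by ring
  omega

theorem fptComputable_reduction : FPTComputable maxKSetCover weightedCircuitSat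
    fun a => (a.1.circuit a.2, a.2) := by
  refine ⟨⟨Prog.machine Stk.inp Stk.out reduction, Equiv.refl (FamilySym ⊕ Bool),
    Equiv.refl (CircuitSym ⊕ Bool)⟩, fun s : Stk => inferInstanceAs (Finite (Alph s)),
    fun k => (k + 1) * ((k + 1) * (k + 1)), Polynomial.C 16576 * (Polynomial.X + 1) ^ 6, ?_, ?_⟩
  · have h : Primrec fun k : ℕ => k + 1 := Primrec.succ
    exact (Primrec.nat_mul.comp h (Primrec.nat_mul.comp h h)).to_comp
  · rintro ⟨I, k⟩
    obtain ⟨h₁, h₂⟩ := reduction_time (maxKSetCover.input (I, k)).length k I.n I.m (by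
      have := length_input I k
      omega)
    obtain ⟨o⟩ := (exec_reduction I k h₁ h₂).machine_outputs
    have hin : (maxKSetCover.input (I, k)).map (Equiv.refl (FamilySym ⊕ Bool)).symm =
      maxKSetCover.input (I, k) := List.map_id _
    have hout : (weightedCircuitSat.input (I.circuit k, k)).map
      (Equiv.refl (CircuitSym ⊕ Bool)).symm = weightedCircuitSat.input (I.circuit k, k) :=
      List.map_id _
    refine ⟨?_⟩
    refine hin.symm ▸ hout.symm ▸ ⟨o.toEvalsTo, o.steps_le_m.trans ?_⟩
    simp only [Polynomial.eval_mul, Polynomial.eval_C, Polynomial.eval_pow, Polynomial.eval_add,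
      Polynomial.eval_X, Polynomial.eval_one]
    set L := (maxKSetCover.input (I, k)).length
    have hpos : 1 ≤ 4 * ((k + 1) * (L + 1) ^ 2) := Nat.succ_le_of_lt (by positivity)
    -- Here `259 = 20 + 62 + 102 + 74 + 1`: the coefficients of the cubic bound, all charged to the
    -- cube of the bound on the wires, and the halting step. The constant of the polynomial is
    -- `16576 = 259 * 4 ^ 3`.
    have hB : (k + 1) * ((k + 1) * (k + 1)) * (16576 * (L + 1) ^ 6) =
        259 * (4 * ((k + 1) * (L + 1) ^ 2) *
          (4 * ((k + 1) * (L + 1) ^ 2) * (4 * ((k + 1) * (L + 1) ^ 2)))) := by ring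
    rw [hB]
    generalize 4 * ((k + 1) * (L + 1) ^ 2) = B at hpos
    have h₃ : B ≤ B * B := Nat.le_mul_of_pos_left _ hpos
    have h₄ : B * B ≤ B * (B * B) := Nat.le_mul_of_pos_left _ hpos
    omega

end ParamComplexity

theorem mainTheorem6 : ParamComplexity.InWP ParamComplexity.maxKSetCover :=
  ⟨fun a => (a.1.circuit a.2, a.2), fun a => a.1.circuit_correct a.2,
    ⟨id, Computable.id, fun _ => le_rfl⟩, ParamComplexity.fptComputable_reduction⟩
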